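/- Let $\ell\ge 0$, $V=\mathbb C^\ell$, $R=\mathbb C[x_1,\dots,x_\ell]$, and let $\mathcal A$ be a (finite, possibly empty) set of linear hyperplanes in $V$, $H=\ker\alpha_H$ for $H\in\mathcal A$, with defining polynomial $f=\prod_{H\in\mathcal A}\alpha_H$. Let $\Omega^p_V$ be the module of polynomial $p$-forms on $V$, graded so that the $x_i$ and the $dx_i$ have degree $1$. For $p\ge 0$ let $$\Omega^p(\mathcal A)=\Bigl\{\omega\in\tfrac1f\Omega^p_V \;\Big|\; \tfrac{d\alpha_H}{\alpha_H}\wedge\omega\in\tfrac1f\Omega^{p+1}_V\ \text{ for all } H\in\mathcal A\Bigr\},$$ and let $\Omega^p_0(\mathcal A)=\{\omega\in\Omega^p(\mathcal A)\mid \iota_\chi\omega=0\}$, where $\iota_\chi$ is the contraction with the Euler vector field $\chi=\sum_i x_i\partial_i$. This is a $\mathbb Z$-graded $R$-module; let $\widetilde{\Omega^p_0(\mathcal A)}$ be the associated sheaf of modules on $\mathbb PV=\operatorname{Proj}R$. Let $D=(f)$ be the divisor on $\mathbb PV$ defined by $f$, and let $$\Omega^p(\mathbb P\mathcal A)=\Omega^p_{\mathbb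 PV}(D)\cap d^{-1}\,\Omega^{p+1}_{\mathbb PV}(D)$$ be the sheaf of the rational $p$-forms $\omega$ on $\mathbb PV$ such that both $\omega$ and $d\omega$ have at most simple poles along $D$. Then $\widetilde{\Omega^p_0(\mathcal A)}=\Omega^p(\mathbb P\mathcal A)$ as sheaves on $\mathbb PV$. That is, there is an isomorphism of sheaves of $\mathcal O_{\mathbb PV}$-modules $e\colon\widetilde{\Omega^p_0(\mathcal A)}\to\Omega^p(\mathbb P\mathcal A)$ that is compatible with the pullback $\pi^*$ of rational forms along the projection $\pi\colon V\setminus\{0\}\to\mathbb PV$: for every section $s$ of $\widetilde{\Omega^p_0(\mathcal A)}$ over an open set $U$ and every $x\in U$, the value of $s$ at $x$, a fraction $m/t$ regarded as the rational form $t^{-1}m$ on $V$, is $\pi^*$ of the rational form $e(s)$ on $\mathbb PV$ at $x$. -/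

import Mathlib

open CategoryTheory TopologicalSpace TopCat Opposite AlgebraicGeometry
open scoped KaehlerDifferential

noncomputable section

namespace LogForms

section DeRham

variable (k A : Type*) [CommRing k] [CommRing A] [Algebra k A]

/-- The algebra `⋀_A Ω_{A/k}` of differential forms of a commutative `k`-algebra `A`. -/
abbrev Forms : Type _ := ExteriorAlgebra A Ω[A⁄k]

/-- The `1`-form `da`. -/
abbrev dd (a : A) : Forms k A := ExteriorAlgebra.ι A (KaehlerDifferential.D k A a)

theorem dd_add (a b : A) : dd k A (a + b) = dd k A a + dd k A b := by
  simp only [dd, map_add]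

theorem dd_mul (a b : A) : dd k A (a * b) = a • dd k A b + b • dd k A a := by
  simp only [dd, Derivation.leibniz, map_add, map_smul]

theorem dd_algebraMap (c : k) : dd k A (algebraMap k A c) = 0 := by
  simp only [dd, Derivation.map_algebraMap, map_zero]

/-- Pairs `(ω, θ)` of forms, with the multiplication
`(ω, θ) (ω', θ') = (ω ω', ω̂ θ' + θ ω')`, where `ω̂ = (-1)^p ω` for a `p`-form `ω`.
The pairs `(ω, dω)` are closed under this product, by the Leibniz rule for the exterior derivative.
The type serves only to construct the exterior derivative. -/
def DiffPair : Type _ := Forms k A × Forms k A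

namespace DiffPair

variable {k A}

instance : AddCommGroup (DiffPair k A) := inferInstanceAs (AddCommGroup (Forms k A × Forms k A))

@[ext] theorem ext {x y : DiffPair k A} (h₁ : x.1 = y.1) (h₂ : x.2 = y.2) : x = y := Prod.ext h₁ h₂

/-- The pair `(ω, θ)`. -/
def mk (ω θ : Forms k A) : DiffPair k A := (ω, θ)

@[simp] theorem mk_fst (ω θ : Forms k A) : (mk ω θ).1 = ω := rfl
@[simp] theorem mk_snd (ω θ : Forms k A) : (mk ω θ).2 = θ := rfl

instance : One (DiffPair k A) := ⟨mk 1 0⟩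

instance : Mul (DiffPair k A) :=
  ⟨fun x y => mk (x.1 * y.1) (CliffordAlgebra.involute x.1 * y.2 + x.2 * y.1)⟩

@[simp] theorem zero_fst : (0 : DiffPair k A).1 = 0 := rfl
@[simp] theorem zero_snd : (0 : DiffPair k A).2 = 0 := rfl
@[simp] theorem one_fst : (1 : DiffPair k A).1 = 1 := rfl
@[simp] theorem one_snd : (1 : DiffPair k A).2 = 0 := rfl
@[simp] theorem add_fst (x y : DiffPair k A) : (x + y).1 = x.1 + y.1 := rfl
@[simp] theorem add_snd (x y : DiffPair k A) : (x + y).2 = x.2 + y.2 := rfl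
@[simp] theorem mul_fst (x y : DiffPair k A) : (x * y).1 = x.1 * y.1 := rfl
@[simp] theorem mul_snd (x y : DiffPair k A) :
    (x * y).2 = CliffordAlgebra.involute x.1 * y.2 + x.2 * y.1 := rfl

instance : Ring (DiffPair k A) :=
  { (inferInstance : AddCommGroup (DiffPair k A)),
    (inferInstance : One (DiffPair k A)), (inferInstance : Mul (DiffPair k A)) with
    left_distrib := fun x y z => by ext <;> simp [mul_add]; abel
    right_distrib := fun x y z => by ext <;> simp [add_mul]; abel
    zero_mul := fun x => by ext <;> simp
    mul_zero := fun x => by ext <;> simp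
    mul_assoc := fun x y z => by ext <;> simp [mul_assoc, mul_add, add_mul, add_assoc]
    one_mul := fun x => by ext <;> simp
    mul_one := fun x => by ext <;> simp }

theorem involute_mul_ι (v : Forms k A) (m : Ω[A⁄k]) :
    CliffordAlgebra.involute v * ExteriorAlgebra.ι A m = ExteriorAlgebra.ι A m * v := by
  induction v using ExteriorAlgebra.induction with
  | algebraMap r => simp [Algebra.commutes]
  | ι x =>
    rw [CliffordAlgebra.involute_ι, neg_mul, neg_eq_iff_add_eq_zero]
    exact ExteriorAlgebra.ι_add_mul_swap x m
  | mul a b ha hb => rw [map_mul, mul_assoc, hb, ← mul_assoc, ha, mul_assoc]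
  | add a b ha hb => rw [map_add, add_mul, ha, hb, mul_add]

/-- The ring homomorphism `a ↦ (a, da)`. -/
def ofFun : A →+* DiffPair k A where
  toFun a := mk (algebraMap A _ a) (dd k A a)
  map_one' := by ext <;> simp
  map_zero' := by ext <;> simp
  map_add' a b := by ext <;> simp [dd_add]
  map_mul' a b := by
    ext
    · simp
    · simp only [mul_snd, mk_fst, mk_snd, AlgHom.commutes, dd_mul]
      rw [Algebra.smul_def, Algebra.smul_def, Algebra.commutes b]

@[simp] theorem ofFun_fst (a : A) : (ofFun (k := k) a).1 = algebraMap A _ a := rfl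
@[simp] theorem ofFun_snd (a : A) : (ofFun (k := k) a).2 = dd k A a := rfl

theorem ofFun_comm (a : A) (x : DiffPair k A) : ofFun a * x = x * ofFun a := by
  ext
  · simp [Algebra.commutes]
  · simp [involute_mul_ι, Algebra.commutes, add_comm]

instance : Algebra A (DiffPair k A) := ofFun.toAlgebra' ofFun_comm

instance : Algebra k (DiffPair k A) :=
  (ofFun.comp (algebraMap k A)).toAlgebra' fun _ x => ofFun_comm _ x

instance : IsScalarTower k A (DiffPair k A) := .of_algebraMap_eq fun _ => rfl

theorem smul_def (a : A) (x : DiffPair k A) : a • x = ofFun a * x := rfl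

@[simp] theorem smul_fst (a : A) (x : DiffPair k A) : (a • x).1 = a • x.1 := by
  rw [smul_def, mul_fst, ofFun_fst, Algebra.smul_def]

@[simp] theorem smul_snd (a : A) (x : DiffPair k A) :
    (a • x).2 = a • x.2 + dd k A a * x.1 := by
  rw [smul_def, mul_snd, ofFun_fst, ofFun_snd, AlgHom.commutes, Algebra.smul_def]

/-- The derivation `a ↦ (da, 0)`. -/
def derivation : Derivation k A (DiffPair k A) :=
  Derivation.mk'
    { toFun := fun a => mk (dd k A a) 0
      map_add' := fun a b => by ext <;> simp [dd_add]
      map_smul' := fun c a => by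
        rw [RingHom.id_apply, ← algebraMap_smul A c (mk _ _), Algebra.smul_def c a]
        ext
        · rw [smul_fst, mk_fst, mk_fst, dd_mul, dd_algebraMap, smul_zero, add_zero]
        · rw [smul_snd, mk_snd, mk_snd, mk_fst, dd_algebraMap, smul_zero, zero_mul, add_zero] }
    fun a b => by
      ext
      · simp [dd_mul]
      · simp

theorem derivation_apply (a : A) : derivation (k := k) a = mk (dd k A a) 0 := rfl

theorem lift_derivation_anticomm (ω η : Ω[A⁄k]) :
    derivation.liftKaehlerDifferential ω * derivation.liftKaehlerDifferential η +
      derivation.liftKaehlerDifferential η * derivation.liftKaehlerDifferential ω = 0 := by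
  have hω : ω ∈ Submodule.span A (Set.range (KaehlerDifferential.D k A)) := by
    rw [KaehlerDifferential.span_range_derivation]; trivial
  have hη : η ∈ Submodule.span A (Set.range (KaehlerDifferential.D k A)) := by
    rw [KaehlerDifferential.span_range_derivation]; trivial
  induction hω using Submodule.span_induction with
  | zero => simp
  | add x y _ _ hx hy =>
    rw [map_add, add_mul, mul_add, add_add_add_comm, hx, hy, add_zero]
  | smul a x _ hx => rw [map_smul, smul_mul_assoc, mul_smul_comm, ← smul_add, hx, smul_zero]
  | mem x hx =>
    obtain ⟨a, rfl⟩ := hx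
    induction hη using Submodule.span_induction with
    | zero => simp
    | add x y _ _ hx hy =>
      rw [map_add, add_mul, mul_add, add_add_add_comm, hx, hy, add_zero]
    | smul a x _ hx => rw [map_smul, smul_mul_assoc, mul_smul_comm, ← smul_add, hx, smul_zero]
    | mem y hy =>
      obtain ⟨b, rfl⟩ := hy
      rw [Derivation.liftKaehlerDifferential_comp_D, Derivation.liftKaehlerDifferential_comp_D,
        derivation_apply, derivation_apply]
      ext
      · simp
      · simp

theorem lift_derivation_sq (ω : Ω[A⁄k]) :
    derivation.liftKaehlerDifferential ω * derivation.liftKaehlerDifferential ω = 0 := by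
  have hω : ω ∈ Submodule.span A (Set.range (KaehlerDifferential.D k A)) := by
    rw [KaehlerDifferential.span_range_derivation]; trivial
  induction hω using Submodule.span_induction with
  | zero => simp
  | add x y _ _ hx hy =>
    rw [map_add, add_mul, mul_add, mul_add, hx, hy, zero_add, add_zero,
      lift_derivation_anticomm]
  | smul a x _ hx => rw [map_smul, smul_mul_smul_comm, hx, smul_zero]
  | mem x hx =>
    obtain ⟨a, rfl⟩ := hx
    rw [Derivation.liftKaehlerDifferential_comp_D, derivation_apply]
    ext <;> simp

/-- The algebra homomorphism `ω ↦ (ω, dω)`. -/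
def ofForm : Forms k A →ₐ[A] DiffPair k A :=
  ExteriorAlgebra.lift A ⟨derivation.liftKaehlerDifferential, lift_derivation_sq⟩

end DiffPair

/-- The exterior derivative `d : ⋀ Ω_{A/k} → ⋀ Ω_{A/k}`. -/
def extDiff : Forms k A →+ Forms k A where
  toFun ω := (DiffPair.ofForm ω).2
  map_zero' := by simp
  map_add' := by simp

variable {k A}

theorem ofForm_fst (ω : Forms k A) : (DiffPair.ofForm ω).1 = ω := by
  have hΩ (m : Ω[A⁄k]) :
      (DiffPair.derivation.liftKaehlerDifferential m).1 = ExteriorAlgebra.ι A m := by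
    have hm : m ∈ Submodule.span A (Set.range (KaehlerDifferential.D k A)) := by
      rw [KaehlerDifferential.span_range_derivation]; trivial
    induction hm using Submodule.span_induction with
    | zero => simp
    | add x y _ _ hx hy => rw [map_add, map_add, DiffPair.add_fst, hx, hy]
    | smul a x _ hx =>
      rw [map_smul, map_smul, DiffPair.smul_fst, hx]
    | mem x hx =>
      obtain ⟨a, rfl⟩ := hx
      rw [Derivation.liftKaehlerDifferential_comp_D]
      rfl
  induction ω using ExteriorAlgebra.induction with
  | algebraMap r => rw [AlgHom.commutes]; rfl
  | ι m => rw [DiffPair.ofForm, ExteriorAlgebra.lift_ι_apply, hΩ]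
  | mul a b ha hb => rw [map_mul, DiffPair.mul_fst, ha, hb]
  | add a b ha hb => rw [map_add, DiffPair.add_fst, ha, hb]

theorem extDiff_algebraMap (a : A) : extDiff k A (algebraMap A _ a) = dd k A a := by
  simp only [extDiff, AddMonoidHom.coe_mk, ZeroHom.coe_mk, AlgHom.commutes]
  rfl

theorem extDiff_dd (a : A) : extDiff k A (dd k A a) = 0 := by
  simp only [extDiff, AddMonoidHom.coe_mk, ZeroHom.coe_mk, DiffPair.ofForm]
  rw [ExteriorAlgebra.lift_ι_apply]
  simp [DiffPair.derivation_apply]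

/-- The graded Leibniz rule; `involute` is multiplication by `(-1)^p` on `p`-forms. -/
theorem extDiff_mul (ω η : Forms k A) :
    extDiff k A (ω * η) =
      extDiff k A ω * η + CliffordAlgebra.involute ω * extDiff k A η := by
  simp only [extDiff, AddMonoidHom.coe_mk, ZeroHom.coe_mk, map_mul, DiffPair.mul_snd, ofForm_fst]
  rw [add_comm]

theorem extDiff_smul (a : A) (ω : Forms k A) :
    extDiff k A (a • ω) = dd k A a * ω + a • extDiff k A ω := by
  rw [Algebra.smul_def, extDiff_mul, extDiff_algebraMap, AlgHom.commutes, ← Algebra.smul_def]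

end DeRham

section RegularForms

variable (k B K : Type*) [CommRing k] [CommRing B] [CommRing K] [Algebra k K] [Algebra B K]
  [SMulCommClass k B K]

/-- For a `B`-algebra `K`, the `B`-submodule of `⋀^p_K Ω_{K/k}` generated by the forms
`db₁ ∧ ⋯ ∧ db_p` with `bᵢ ∈ B`. -/
def regularForms (p : ℕ) : Submodule B (Forms k K) :=
  Submodule.span B (Set.range fun b : Fin p → B =>
    ExteriorAlgebra.ιMulti K p fun i => KaehlerDifferential.D k K (algebraMap B K (b i)))

variable {k B K}

theorem dd_mul_mem_regularForms {p : ℕ} (b : B) {ω : Forms k K} (hω : ω ∈ regularForms k B K p) :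
    dd k K (algebraMap B K b) * ω ∈ regularForms k B K (p + 1) := by
  induction hω using Submodule.span_induction with
  | zero => simp
  | add x y _ _ hx hy => rw [mul_add]; exact add_mem hx hy
  | smul c x _ hx => rw [mul_smul_comm]; exact Submodule.smul_mem _ _ hx
  | mem x hx =>
    obtain ⟨v, rfl⟩ := hx
    refine Submodule.subset_span ⟨Fin.cons b v, ?_⟩
    beta_reduce
    rw [ExteriorAlgebra.ιMulti_succ_apply]
    simp [Matrix.vecTail, Function.comp_def]

end RegularForms

section Affine

/-- The coordinate ring `R = ℂ[x₁, …, x_ℓ]` of `V = ℂ^ℓ`. -/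
abbrev CoordRing (ℓ : ℕ) : Type := MvPolynomial (Fin ℓ) ℂ

/-- The field `ℂ(x₁, …, x_ℓ)` of rational functions on `V`. -/
abbrev RatFun (ℓ : ℕ) : Type := FractionRing (CoordRing ℓ)

/-- The grading of `R` by the degree. -/
abbrev grading (ℓ : ℕ) : ℕ → Submodule ℂ (CoordRing ℓ) :=
  MvPolynomial.homogeneousSubmodule (Fin ℓ) ℂ

instance (ℓ : ℕ) : GradedAlgebra (grading ℓ) := MvPolynomial.gradedAlgebra

/-- A linear form on `ℂ^ℓ` as an element of `R`. -/
def linPoly {ℓ : ℕ} (α : Module.Dual ℂ (Fin ℓ → ℂ)) : CoordRing ℓ :=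
  ∑ i, MvPolynomial.C (α (Pi.single i 1)) * MvPolynomial.X i

/-- A central arrangement in `V = ℂ^ℓ`: a finite set of linear hyperplanes `H`, each with a
linear form `α_H` that defines it. -/
structure Arrangement (ℓ : ℕ) where
  /-- the hyperplanes -/
  hyperplanes : Finset (Submodule ℂ (Fin ℓ → ℂ))
  /-- the defining linear forms -/
  form : hyperplanes → Module.Dual ℂ (Fin ℓ → ℂ)
  form_ne_zero : ∀ H, form H ≠ 0
  ker_form : ∀ H, LinearMap.ker (form H) = H

variable {ℓ : ℕ}

/-- `α_H` as a polynomial. -/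
def Arrangement.poly (𝒜 : Arrangement ℓ) (H : 𝒜.hyperplanes) : CoordRing ℓ := linPoly (𝒜.form H)

/-- The number of hyperplanes. -/
abbrev Arrangement.card (𝒜 : Arrangement ℓ) : ℕ := 𝒜.hyperplanes.card

/-- The defining polynomial `f = ∏ α_H`. -/
def Arrangement.defPoly (𝒜 : Arrangement ℓ) : CoordRing ℓ := ∏ H, 𝒜.poly H

theorem linPoly_mem (α : Module.Dual ℂ (Fin ℓ → ℂ)) : linPoly α ∈ grading ℓ 1 :=
  sum_mem fun i _ => MvPolynomial.isHomogeneous_C_mul_X _ i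

theorem Arrangement.defPoly_mem (𝒜 : Arrangement ℓ) : 𝒜.defPoly ∈ grading ℓ 𝒜.card := by
  have h := MvPolynomial.IsHomogeneous.prod Finset.univ 𝒜.poly (fun _ => 1)
    fun H _ => linPoly_mem (𝒜.form H)
  simpa [Arrangement.defPoly] using h

variable (ℓ) in
/-- The rational forms `⋀ Ω_{ℂ(V)/ℂ}` on `V`. -/
abbrev RatForms : Type := Forms ℂ (RatFun ℓ)

variable (ℓ) in
/-- The polynomial `p`-forms `Ω^p_V`, inside the rational forms. -/
abbrev polyForms (p : ℕ) : Submodule (CoordRing ℓ) (RatForms ℓ) :=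
  regularForms ℂ (CoordRing ℓ) (RatFun ℓ) p

/-- The module `(1/f) Ω^p_V`. -/
def Arrangement.simplePoles (𝒜 : Arrangement ℓ) (p : ℕ) : Submodule (CoordRing ℓ) (RatForms ℓ) :=
  (polyForms ℓ p).comap (LinearMap.lsmul (CoordRing ℓ) (RatForms ℓ) 𝒜.defPoly)

/-- The logarithmic `1`-form `dα_H / α_H`. -/
def Arrangement.dlog (𝒜 : Arrangement ℓ) (H : 𝒜.hyperplanes) : RatForms ℓ :=
  (algebraMap (CoordRing ℓ) (RatFun ℓ) (𝒜.poly H))⁻¹ •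
    dd ℂ (RatFun ℓ) (algebraMap (CoordRing ℓ) (RatFun ℓ) (𝒜.poly H))

/-- The module `Ω^p(𝒜)` of logarithmic `p`-forms: the `ω ∈ (1/f) Ω^p_V` with
`dα_H / α_H ∧ ω ∈ (1/f) Ω^{p+1}_V` for all `H ∈ 𝒜`. -/
def Arrangement.logForms (𝒜 : Arrangement ℓ) (p : ℕ) : Submodule (CoordRing ℓ) (RatForms ℓ) :=
  𝒜.simplePoles p ⊓
    ⨅ H, (𝒜.simplePoles (p + 1)).comap (LinearMap.mulLeft (CoordRing ℓ) (𝒜.dlog H))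

variable (ℓ) in
/-- The pairing `Ω_{ℂ(V)/ℂ} → ℂ(V)` with the Euler field `χ = ∑ xᵢ ∂ᵢ`:
the linear map with `df ↦ χ(f) = ∑ xᵢ ∂f/∂xᵢ` for polynomials `f`. -/
def eulerPairing : Module.Dual (RatFun ℓ) Ω[RatFun ℓ⁄ℂ] :=
  LinearMap.extendScalarsOfIsLocalization (nonZeroDivisors (CoordRing ℓ)) (RatFun ℓ)
    (IsLocalizedModule.lift (nonZeroDivisors (CoordRing ℓ))
      (KaehlerDifferential.map ℂ ℂ (CoordRing ℓ) (RatFun ℓ))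
      ((Algebra.linearMap (CoordRing ℓ) (RatFun ℓ)).comp
        (MvPolynomial.mkDerivation ℂ MvPolynomial.X :
          Derivation ℂ (CoordRing ℓ) (CoordRing ℓ)).liftKaehlerDifferential)
      (IsLocalizedModule.map_units (Algebra.linearMap (CoordRing ℓ) (RatFun ℓ))))

theorem eulerPairing_D_X (i : Fin ℓ) :
    eulerPairing ℓ (KaehlerDifferential.D ℂ (RatFun ℓ)
      (algebraMap (CoordRing ℓ) (RatFun ℓ) (MvPolynomial.X i))) =
      algebraMap (CoordRing ℓ) (RatFun ℓ) (MvPolynomial.X i) := by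
  have h := IsLocalizedModule.lift_apply (nonZeroDivisors (CoordRing ℓ))
    (KaehlerDifferential.map ℂ ℂ (CoordRing ℓ) (RatFun ℓ))
    ((Algebra.linearMap (CoordRing ℓ) (RatFun ℓ)).comp
      (MvPolynomial.mkDerivation ℂ MvPolynomial.X :
        Derivation ℂ (CoordRing ℓ) (CoordRing ℓ)).liftKaehlerDifferential)
    (IsLocalizedModule.map_units (Algebra.linearMap (CoordRing ℓ) (RatFun ℓ)))
    (KaehlerDifferential.D ℂ (CoordRing ℓ) (MvPolynomial.X i))
  rw [KaehlerDifferential.map_D] at h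
  refine h.trans ?_
  rw [LinearMap.comp_apply, Derivation.liftKaehlerDifferential_comp_D, Algebra.linearMap_apply,
    MvPolynomial.mkDerivation_X]

variable (ℓ) in
/-- The contraction `ι_χ` of rational forms with the Euler field. -/
def eulerContract : RatForms ℓ →ₗ[RatFun ℓ] RatForms ℓ :=
  CliffordAlgebra.contractLeft (Q := (0 : QuadraticForm (RatFun ℓ) Ω[RatFun ℓ⁄ℂ])) (eulerPairing ℓ)

/-- The module `Ω^p_0(𝒜)` of the logarithmic `p`-forms that `ι_χ` annihilates. -/
def Arrangement.logForms₀ (𝒜 : Arrangement ℓ) (p : ℕ) : Submodule (CoordRing ℓ) (RatForms ℓ) :=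
  𝒜.logForms p ⊓ LinearMap.ker ((eulerContract ℓ).restrictScalars (CoordRing ℓ))

variable (ℓ) in
/-- The rational `p`-forms that are homogeneous of degree `n ∈ ℤ`, where the `xᵢ` and the `dxᵢ` have
degree `1`. -/
def homogeneousForms (p : ℕ) (n : ℤ) : AddSubgroup (RatForms ℓ) :=
  AddSubgroup.closure {ω | ∃ (c e : ℕ) (a b : CoordRing ℓ) (i : Fin p → Fin ℓ),
    a ∈ grading ℓ c ∧ b ∈ grading ℓ e ∧ b ≠ 0 ∧ (c : ℤ) - e + p = n ∧
    ω = (algebraMap (CoordRing ℓ) (RatFun ℓ) a / algebraMap (CoordRing ℓ) (RatFun ℓ) b) •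
      ExteriorAlgebra.ιMulti (RatFun ℓ) p fun j =>
        KaehlerDifferential.D ℂ (RatFun ℓ) 
          (algebraMap (CoordRing ℓ) (RatFun ℓ) (MvPolynomial.X (i j)))}

theorem smul_mem_homogeneousForms {p m : ℕ} {n : ℤ} {r : CoordRing ℓ} (hr : r ∈ grading ℓ m)
    {ω : RatForms ℓ} (hω : ω ∈ homogeneousForms ℓ p n) :
    r • ω ∈ homogeneousForms ℓ p (m + n) := by
  induction hω using AddSubgroup.closure_induction with
  | zero => simp
  | add x y _ _ hx hy => rw [smul_add]; exact add_mem hx hy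
  | neg x _ hx => rw [smul_neg]; exact neg_mem hx
  | mem x hx =>
    obtain ⟨c, e, a, b, i, ha, hb, hb0, hn, rfl⟩ := hx
    refine AddSubgroup.subset_closure
      ⟨m + c, e, r * a, b, i, SetLike.mul_mem_graded hr ha, hb, hb0, ?_, ?_⟩
    · push_cast
      omega
    · rw [← algebraMap_smul (RatFun ℓ) r, smul_smul, map_mul, mul_div_assoc]

/-- The homogeneous component of degree `n` of `Ω^p_0(𝒜)`. -/
def Arrangement.logForms₀Degree (𝒜 : Arrangement ℓ) (p : ℕ) (n : ℤ) :
    AddSubgroup (𝒜.logForms₀ p) :=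
  (homogeneousForms ℓ p n).comap (𝒜.logForms₀ p).toAddSubgroup.subtype

end Affine

section FunctionField

variable {ℓ : ℕ}

variable (ℓ) in
/-- The fractions `a / b` of homogeneous polynomials of the same degree, as a subfield of `ℂ(V)`. -/
def homogeneousFractions : IntermediateField ℂ (RatFun ℓ) where
  carrier := {z | ∃ (m : ℕ) (a b : CoordRing ℓ), a ∈ grading ℓ m ∧ b ∈ grading ℓ m ∧ b ≠ 0 ∧
    z = algebraMap _ _ a / algebraMap _ _ b}
  mul_mem' := by
    rintro _ _ ⟨m, a, b, ha, hb, hb0, rfl⟩ ⟨n, c, e, hc, he, he0, rfl⟩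
    exact ⟨m + n, a * c, b * e, SetLike.mul_mem_graded ha hc, SetLike.mul_mem_graded hb he,
      mul_ne_zero hb0 he0, by rw [map_mul, map_mul, div_mul_div_comm]⟩
  add_mem' := by
    rintro _ _ ⟨m, a, b, ha, hb, hb0, rfl⟩ ⟨n, c, e, hc, he, he0, rfl⟩
    refine ⟨m + n, a * e + b * c, b * e, add_mem (SetLike.mul_mem_graded ha he)
      (SetLike.mul_mem_graded hb hc), SetLike.mul_mem_graded hb he, mul_ne_zero hb0 he0, ?_⟩
    rw [map_add, map_mul, map_mul, map_mul, div_add_div]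
    · exact (map_ne_zero_iff _ (IsFractionRing.injective (CoordRing ℓ) (RatFun ℓ))).2 hb0
    · exact (map_ne_zero_iff _ (IsFractionRing.injective (CoordRing ℓ) (RatFun ℓ))).2 he0
  algebraMap_mem' c := ⟨0, algebraMap ℂ _ c, 1, SetLike.algebraMap_mem_graded _ c,
    SetLike.one_mem_graded _, one_ne_zero, by
      rw [map_one, div_one, ← IsScalarTower.algebraMap_apply]⟩
  inv_mem' := by
    rintro _ ⟨m, a, b, ha, hb, hb0, rfl⟩
    by_cases ha0 : a = 0
    · exact ⟨m, 0, b, zero_mem _, hb, hb0, by simp [ha0]⟩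
    · exact ⟨m, b, a, hb, ha, ha0, by rw [inv_div]⟩

variable (ℓ) in
/-- The field `ℂ(ℙV)` of rational functions on `ℙV`: the fractions `a / b` of homogeneous polynomials
of the same degree. -/
def ProjRatFun : Type := homogeneousFractions ℓ

instance : Field (ProjRatFun ℓ) := inferInstanceAs (Field (homogeneousFractions ℓ))

instance : Algebra ℂ (ProjRatFun ℓ) := inferInstanceAs (Algebra ℂ (homogeneousFractions ℓ))

instance : Algebra (ProjRatFun ℓ) (RatFun ℓ) :=
  inferInstanceAs (Algebra (homogeneousFractions ℓ) (RatFun ℓ))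

instance : IsScalarTower ℂ (ProjRatFun ℓ) (RatFun ℓ) :=
  inferInstanceAs (IsScalarTower ℂ (homogeneousFractions ℓ) (RatFun ℓ))

variable (ℓ) in
/-- The rational forms `⋀ Ω_{ℂ(ℙV)/ℂ}` on `ℙV`. -/
abbrev ProjRatForms : Type := Forms ℂ (ProjRatFun ℓ)

/-- The local ring of `ℙV = Proj R` at `x`: the fractions `a / s` of homogeneous polynomials of the
same degree with `s ∉ x`. -/
abbrev LocalRingAt (x : ProjectiveSpectrum (grading ℓ)) : Type :=
  HomogeneousLocalization.AtPrime (grading ℓ) x.asHomogeneousIdeal.toIdeal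

/-- The inclusion of the local ring at `x` into `ℂ(ℙV)`. -/
def LocalRingAt.toRatFun (x : ProjectiveSpectrum (grading ℓ)) :
    LocalRingAt x →+* ProjRatFun ℓ :=
  ((IsLocalization.lift (M := x.asHomogeneousIdeal.toIdeal.primeCompl)
      (S := Localization x.asHomogeneousIdeal.toIdeal.primeCompl)
      (g := algebraMap (CoordRing ℓ) (RatFun ℓ))
      (fun s => IsUnit.mk0 _ ((map_ne_zero_iff _ (IsFractionRing.injective _ _)).2
        fun h => s.2 (h ▸ zero_mem _)))).comp
    (algebraMap (LocalRingAt x) (Localization x.asHomogeneousIdeal.toIdeal.primeCompl))).codRestrict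
    (homogeneousFractions ℓ) (by
      intro z
      obtain ⟨⟨m, a, b, hb⟩, rfl⟩ := HomogeneousLocalization.mk_surjective z
      refine ⟨m, a, b, a.2, b.2, fun h => hb (h ▸ zero_mem _), ?_⟩
      rw [RingHom.comp_apply, HomogeneousLocalization.algebraMap_apply,
        HomogeneousLocalization.val_mk, Localization.mk_eq_mk', IsLocalization.lift_mk',
        div_eq_mul_inv]
      congr 1
      exact Units.val_inv_eq_inv_val _)

instance (x : ProjectiveSpectrum (grading ℓ)) : Algebra (LocalRingAt x) (ProjRatFun ℓ) :=
  (LocalRingAt.toRatFun x).toAlgebra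

instance (x : ProjectiveSpectrum (grading ℓ)) :
    SMulCommClass ℂ (LocalRingAt x) (ProjRatFun ℓ) :=
  ⟨fun c r z => by rw [Algebra.smul_def r, Algebra.smul_def r, mul_smul_comm]⟩

theorem algebraMap_mk (x : ProjectiveSpectrum (grading ℓ)) (m : ℕ) (a b : grading ℓ m)
    (hb : (b : CoordRing ℓ) ∈ x.asHomogeneousIdeal.toIdeal.primeCompl) :
    algebraMap (ProjRatFun ℓ) (RatFun ℓ)
        (algebraMap (LocalRingAt x) (ProjRatFun ℓ) (.mk ⟨m, a, b, hb⟩)) =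
      algebraMap _ _ (a : CoordRing ℓ) / algebraMap _ _ (b : CoordRing ℓ) := by
  change IsLocalization.lift (M := x.asHomogeneousIdeal.toIdeal.primeCompl)
    (g := algebraMap (CoordRing ℓ) (RatFun ℓ)) _
    (HomogeneousLocalization.val (x := x.asHomogeneousIdeal.toIdeal.primeCompl)
      (.mk ⟨m, a, b, hb⟩)) = _
  rw [HomogeneousLocalization.val_mk, Localization.mk_eq_mk', IsLocalization.lift_mk',
    div_eq_mul_inv]
  congr 1
  exact Units.val_inv_eq_inv_val _

/-- The stalk at `x` of the sheaf `Ω^p_{ℙV}`, inside the rational forms. -/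
abbrev projForms (x : ProjectiveSpectrum (grading ℓ)) (p : ℕ) :
    Submodule (LocalRingAt x) (ProjRatForms ℓ) :=
  regularForms ℂ (LocalRingAt x) (ProjRatFun ℓ) p

/-- The local equation `f / s` at `x` of the divisor `D = (f)` on `ℙV`, where `s ∉ x` is homogeneous
of degree `deg f`. -/
def Arrangement.localEq (𝒜 : Arrangement ℓ) (x : ProjectiveSpectrum (grading ℓ))
    (s : grading ℓ 𝒜.card) (hs : (s : CoordRing ℓ) ∉ x.asHomogeneousIdeal) : LocalRingAt x :=
  .mk ⟨𝒜.card, ⟨𝒜.defPoly, 𝒜.defPoly_mem⟩, s, hs⟩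

/-- The stalk at `x` of the sheaf `Ω^p_{ℙV}(D)`: the rational forms `ω` such that
`f_x ω` is regular at `x` for the local equations `f_x` of `D`. -/
def Arrangement.projSimplePoles (𝒜 : Arrangement ℓ) (x : ProjectiveSpectrum (grading ℓ))
    (p : ℕ) : Submodule (LocalRingAt x) (ProjRatForms ℓ) :=
  ⨅ (s : grading ℓ 𝒜.card) (hs : (s : CoordRing ℓ) ∉ x.asHomogeneousIdeal),
    (projForms x p).comap (LinearMap.lsmul (LocalRingAt x) (ProjRatForms ℓ) (𝒜.localEq x s hs))

/-- The stalk at `x` of the sheaf `Ω^p(ℙ𝒜) = Ω^p_{ℙV}(D) ∩ d⁻¹ Ω^{p+1}_{ℙV}(D)`. -/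
def Arrangement.projLogForms (𝒜 : Arrangement ℓ) (x : ProjectiveSpectrum (grading ℓ))
    (p : ℕ) : Submodule (LocalRingAt x) (ProjRatForms ℓ) where
  carrier := {ω | ω ∈ 𝒜.projSimplePoles x p ∧
    extDiff ℂ (ProjRatFun ℓ) ω ∈ 𝒜.projSimplePoles x (p + 1)}
  zero_mem' := ⟨zero_mem _, by rw [map_zero]; exact zero_mem _⟩
  add_mem' := fun h₁ h₂ => ⟨add_mem h₁.1 h₂.1, by rw [map_add]; exact add_mem h₁.2 h₂.2⟩
  smul_mem' := fun r ω h => by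
    refine ⟨Submodule.smul_mem _ _ h.1, ?_⟩
    rw [← algebraMap_smul (ProjRatFun ℓ) r ω, extDiff_smul, algebraMap_smul]
    refine add_mem ?_ (Submodule.smul_mem _ _ h.2)
    have h1 := h.1
    simp only [Arrangement.projSimplePoles, Submodule.mem_iInf, Submodule.mem_comap,
      LinearMap.lsmul_apply] at h1 ⊢
    intro s hs
    rw [← mul_smul_comm]
    exact dd_mul_mem_regularForms r (h1 s hs)

variable (ℓ) in
/-- The pullback of rational `1`-forms along `π : V ∖ {0} → ℙV`, with `dz ↦ dz` for
`z ∈ ℂ(ℙV) ⊆ ℂ(V)`. -/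
def projPullbackOne : Ω[ProjRatFun ℓ⁄ℂ] →ₗ[ProjRatFun ℓ] RatForms ℓ :=
  ((ExteriorAlgebra.ι (RatFun ℓ) : Ω[RatFun ℓ⁄ℂ] →ₗ[RatFun ℓ] RatForms ℓ).restrictScalars
    (ProjRatFun ℓ)).comp (KaehlerDifferential.map ℂ ℂ (ProjRatFun ℓ) (RatFun ℓ))

theorem projPullbackOne_sq (m : Ω[ProjRatFun ℓ⁄ℂ]) :
    projPullbackOne ℓ m * projPullbackOne ℓ m = 0 :=
  ExteriorAlgebra.ι_sq_zero (R := RatFun ℓ) (KaehlerDifferential.map ℂ ℂ (ProjRatFun ℓ) (RatFun ℓ) m)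

variable (ℓ) in
/-- The pullback `π^*` of rational forms along `π : V ∖ {0} → ℙV`. -/
def projPullback : ProjRatForms ℓ →ₐ[ProjRatFun ℓ] RatForms ℓ :=
  ExteriorAlgebra.lift (ProjRatFun ℓ) ⟨projPullbackOne ℓ, projPullbackOne_sq⟩

end FunctionField

section Sheaves

universe u

variable {R σ : Type u} [CommRing R] [SetLike σ R] [AddSubgroupClass σ R]

/-- The value in the local ring `R_(x)` of a section of the structure sheaf of `Proj ℛ`. -/
def sectionValue {ℛ : ℕ → σ} [GradedRing ℛ] {U : Opens (ProjectiveSpectrum ℛ)}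
    (r : (ProjectiveSpectrum.Proj.structureSheaf ℛ).1.obj (op U)) (x : U) :
    HomogeneousLocalization.AtPrime ℛ x.1.asHomogeneousIdeal.toIdeal :=
  r.1 x

/-- Data for a sheaf of modules on `Proj ℛ`. Its sections over `U` are the families
`(s_x)_{x ∈ U}`, `s_x ∈ N x`, that are locally given by an index `i`, where `Rel i x z` says that the
index `i` gives the value `z` at `x`. -/
structure LocalSections (ℛ : ℕ → σ) [GradedRing ℛ] where
  /-- the modules in which the sections take their values -/
  N : ProjectiveSpectrum ℛ → Type u
  [addCommGroup : ∀ x, AddCommGroup (N x)]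
  [module : ∀ x, Module (HomogeneousLocalization.AtPrime ℛ x.asHomogeneousIdeal.toIdeal) (N x)]
  /-- the indices -/
  ι : Type u
  /-- the index `i` gives the value `z` at `x` -/
  Rel : ι → ∀ x, N x → Prop
  zero_rel : ∃ i, ∀ x, Rel i x 0
  add_rel : ∀ i j, ∃ k, ∀ x z w, Rel i x z → Rel j x w → Rel k x (z + w)
  smul_rel : ∀ (i : ι) (d : ℕ) (a b : ℛ d), ∃ k, ∀ x
    (hb : (b : R) ∈ x.asHomogeneousIdeal.toIdeal.primeCompl) (z : N x), Rel i x z →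
      Rel k x ((.mk ⟨d, a, b, hb⟩ :
        HomogeneousLocalization.AtPrime ℛ x.asHomogeneousIdeal.toIdeal) • z)

namespace LocalSections

attribute [instance] addCommGroup module

variable {ℛ : ℕ → σ} [GradedRing ℛ] (S : LocalSections ℛ)

/-- The condition that a family over `U` is given by one index. -/
def prelocalPredicate : PrelocalPredicate (X := ProjectiveSpectrum.top ℛ) S.N where
  pred {_} f := ∃ i, ∀ x, S.Rel i _ (f x)
  res := fun j _ ⟨i, hi⟩ => ⟨i, fun x => hi (j x)⟩

/-- The condition that a family over `U` is locally given by an index. -/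
def localPredicate : LocalPredicate (X := ProjectiveSpectrum.top ℛ) S.N :=
  S.prelocalPredicate.sheafify

/-- A family over `U` that is locally given by an index. -/
def IsSection {U : Opens (ProjectiveSpectrum ℛ)} (s : ∀ x : U, S.N x) : Prop :=
  ∀ x : U, ∃ V : Opens (ProjectiveSpectrum ℛ), x.1 ∈ V ∧ ∃ (hVU : V ≤ U) (i : S.ι),
    ∀ y : V, S.Rel i y (s ⟨y.1, hVU y.2⟩)

theorem isSection_iff {U : Opens (ProjectiveSpectrum ℛ)} (s : ∀ x : U, S.N x) :
    S.IsSection s ↔ S.localPredicate.pred (U := U) s :=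
  ⟨fun h x => let ⟨V, hx, hVU, i, hi⟩ := h x; ⟨V, hx, homOfLE hVU, i, hi⟩,
    fun h x => let ⟨V, hx, j, i, hi⟩ := h x; ⟨V, hx, leOfHom j, i, hi⟩⟩

theorem isSection_zero {U : Opens (ProjectiveSpectrum ℛ)} :
    S.IsSection (fun _ : U => 0) := by
  obtain ⟨i, hi⟩ := S.zero_rel
  exact fun x => ⟨U, x.2, le_rfl, i, fun y => hi y⟩

theorem IsSection.add {U : Opens (ProjectiveSpectrum ℛ)} {s t : ∀ x : U, S.N x}
    (hs : S.IsSection s) (ht : S.IsSection t) : S.IsSection (fun x => s x + t x) := by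
  intro x
  obtain ⟨V, hxV, hVU, i, hi⟩ := hs x
  obtain ⟨W, hxW, hWU, j, hj⟩ := ht x
  obtain ⟨k, hk⟩ := S.add_rel i j
  exact ⟨V ⊓ W, ⟨hxV, hxW⟩, inf_le_left.trans hVU, k,
    fun y => hk _ _ _ (hi ⟨y.1, y.2.1⟩) (hj ⟨y.1, y.2.2⟩)⟩

theorem IsSection.smul {U : Opens (ProjectiveSpectrum ℛ)} {s : ∀ x : U, S.N x}
    (hs : S.IsSection s) (r : (ProjectiveSpectrum.Proj.structureSheaf ℛ).1.obj (op U)) :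
    S.IsSection (fun x => sectionValue r x • s x) := by
  intro x
  obtain ⟨V, hxV, hVU, i, hi⟩ := hs x
  obtain ⟨W, hxW, hWU, d, a, b, hb, hr⟩ := r.2 x
  obtain ⟨k, hk⟩ := S.smul_rel i d a b
  let W' : Opens (ProjectiveSpectrum ℛ) := W
  refine ⟨V ⊓ W', ⟨hxV, hxW⟩, inf_le_left.trans hVU, k, fun y => ?_⟩
  have h := hk y.1 (hb ⟨y.1, y.2.2⟩) _ (hi ⟨y.1, y.2.1⟩)
  have e : sectionValue r ⟨y.1, hVU y.2.1⟩ =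
      .mk ⟨d, a, b, hb ⟨y.1, y.2.2⟩⟩ := hr ⟨y.1, y.2.2⟩
  exact (congrArg (fun z => S.Rel k y.1 (z • s ⟨y.1, hVU y.2.1⟩)) e).mpr h

/-- The sections over `U`. -/
def sections (U : Opens (ProjectiveSpectrum ℛ)) : AddSubgroup (∀ x : U, S.N x) where
  carrier := {s | S.IsSection s}
  zero_mem' := S.isSection_zero
  add_mem' := IsSection.add S
  neg_mem' {s} hs := by
    have h := IsSection.smul S hs (-1)
    convert! h using 2 with x
    exact (neg_one_smul _ (s x)).symm

instance sectionsModule (U : Opens (ProjectiveSpectrum ℛ)) :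
    Module ((ProjectiveSpectrum.Proj.structureSheaf ℛ).1.obj (op U)) (S.sections U) where
  smul r s := ⟨fun x => sectionValue r x • s.1 x, IsSection.smul S s.2 r⟩
  one_smul s := Subtype.ext (funext fun x => one_smul _ (s.1 x))
  mul_smul r r' s := Subtype.ext (funext fun x =>
    mul_smul (sectionValue r x) (sectionValue r' x) (s.1 x))
  smul_zero r := Subtype.ext (funext fun x => smul_zero (sectionValue r x))
  smul_add r s t := Subtype.ext (funext fun x => smul_add (sectionValue r x) (s.1 x) (t.1 x))
  add_smul r r' s := Subtype.ext (funext fun x =>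
    add_smul (sectionValue r x) (sectionValue r' x) (s.1 x))
  zero_smul s := Subtype.ext (funext fun x => zero_smul _ (s.1 x))

/-- The presheaf of abelian groups of the sections. -/
def presheafAb : TopCat.Presheaf Ab.{u} (Proj ℛ) where
  obj U := .of (S.sections U.unop)
  map {U V} i := AddCommGrpCat.ofHom
    { toFun := fun s => ⟨fun x => s.1 ⟨x.1, leOfHom i.unop x.2⟩, fun x => by
        obtain ⟨W, hxW, hWU, j, hj⟩ := s.2 ⟨x.1, leOfHom i.unop x.2⟩
        exact ⟨W ⊓ V.unop, ⟨hxW, x.2⟩, inf_le_right, j, fun y => hj ⟨y.1, y.2.1⟩⟩⟩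
      map_zero' := rfl
      map_add' := fun _ _ => rfl }

/-- Forgetting the group structure gives the sheaf of families with a local condition. -/
def presheafAbForget :
    S.presheafAb ⋙ forget Ab.{u} ≅ (subsheafToTypes S.localPredicate).1 :=
  NatIso.ofComponents fun U => Equiv.toIso
    (Equiv.subtypeEquivRight fun s => S.isSection_iff (U := U.unop) s)

/-- The sheaf of modules on `Proj ℛ`. -/
def toModules : (Proj ℛ).Modules where
  val :=
    letI (U : (Opens (Proj ℛ))ᵒᵖ) :
        Module ((Proj ℛ).ringCatSheaf.obj.obj U) (S.presheafAb.obj U) :=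
      S.sectionsModule U.unop
    .ofPresheaf S.presheafAb fun _ _ _ _ _ => rfl
  isSheaf := (TopCat.Presheaf.isSheaf_iff_isSheaf_comp (forget AddCommGrpCat) _).2
    (TopCat.Presheaf.isSheaf_of_iso S.presheafAbForget.symm (subsheafToTypes S.localPredicate).2)

/-- The value `s_x ∈ N x` of a section `s` over `U` at `x ∈ U`. -/
def value {U : (Proj ℛ).Opens} (s : Γ(S.toModules, U)) (x : ProjectiveSpectrum ℛ) (hx : x ∈ U) :
    S.N x :=
  Subtype.val (p := fun t => t ∈ S.sections U) s ⟨x, hx⟩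

end LocalSections

end Sheaves

section AssociatedSheaf

universe u

variable {R σ : Type u} [CommRing R] [SetLike σ R] [AddSubgroupClass σ R]
  (ℛ : ℕ → σ) [GradedRing ℛ]
  (M : Type u) [AddCommGroup M] [Module R M] (ℳ : ℤ → AddSubgroup M)
  (hℳ : ∀ (i : ℕ) (j : ℤ) (r : R) (m : M), r ∈ ℛ i → m ∈ ℳ j → r • m ∈ ℳ (i + j))

/-- The sheaf `M^~` on `Proj ℛ` associated to a `ℤ`-graded module `M` with homogeneous components `ℳ d`:
its sections are the families of `s_x ∈ M_x` that are locally fractions `m / s` with `m`, `s` homogeneous of the same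
degree. -/
def gradedTildeSections : LocalSections ℛ where
  N x := LocalizedModule x.asHomogeneousIdeal.toIdeal.primeCompl M
  module x := Module.compHom _ (algebraMap
    (HomogeneousLocalization.AtPrime ℛ x.asHomogeneousIdeal.toIdeal)
    (Localization x.asHomogeneousIdeal.toIdeal.primeCompl))
  ι := (d : ℕ) × ℳ d × ℛ d
  Rel i x z := ∃ hs : (i.2.2 : R) ∈ x.asHomogeneousIdeal.toIdeal.primeCompl,
    z = LocalizedModule.mk (i.2.1 : M) ⟨(i.2.2 : R), hs⟩
  zero_rel := ⟨⟨0, 0, ⟨1, SetLike.one_mem_graded ℛ⟩⟩, fun x => ⟨Submonoid.one_mem _, by simp⟩⟩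
  add_rel := by
    rintro ⟨d, ⟨m, hm⟩, ⟨s, hs⟩⟩ ⟨e, ⟨n, hn⟩, ⟨t, ht⟩⟩
    refine ⟨⟨d + e, ⟨t • m + s • n, ?_⟩, ⟨s * t, SetLike.mul_mem_graded hs ht⟩⟩, ?_⟩
    · push_cast
      refine add_mem ?_ (hℳ d e s n hs hn)
      rw [add_comm]
      exact hℳ e d t m ht hm
    · rintro x _ _ ⟨hsx, rfl⟩ ⟨htx, rfl⟩
      exact ⟨Submonoid.mul_mem _ hsx htx, LocalizedModule.mk_add_mk⟩
  smul_rel := by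
    rintro ⟨d, ⟨m, hm⟩, ⟨s, hs⟩⟩ e ⟨a, ha⟩ ⟨b, hb⟩
    refine ⟨⟨e + d, ⟨a • m, ?_⟩, ⟨b * s, SetLike.mul_mem_graded hb hs⟩⟩, ?_⟩
    · push_cast
      exact hℳ e d a m ha hm
    · rintro x hbx _ ⟨hsx, rfl⟩
      refine ⟨Submonoid.mul_mem _ hbx hsx, ?_⟩
      change HomogeneousLocalization.val (x := x.asHomogeneousIdeal.toIdeal.primeCompl)
        (.mk ⟨e, ⟨a, ha⟩, ⟨b, hb⟩, hbx⟩) • LocalizedModule.mk m ⟨s, hsx⟩ = _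
      rw [HomogeneousLocalization.val_mk, LocalizedModule.mk_smul_mk]
      rfl

end AssociatedSheaf

section LogSheaves

variable {ℓ : ℕ} (𝒜 : Arrangement ℓ) (p : ℕ)

theorem Arrangement.smul_mem_logForms₀Degree (i : ℕ) (j : ℤ) (r : CoordRing ℓ)
    (m : 𝒜.logForms₀ p) (hr : r ∈ grading ℓ i) (hm : m ∈ 𝒜.logForms₀Degree p j) :
    r • m ∈ 𝒜.logForms₀Degree p (i + j) :=
  smul_mem_homogeneousForms hr hm

/-- The description of the sheaf associated to `Ω^p_0(𝒜)` by its sections. -/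
abbrev Arrangement.tildeSections : LocalSections (grading ℓ) :=
  gradedTildeSections (grading ℓ) (𝒜.logForms₀ p) (𝒜.logForms₀Degree p)
    (𝒜.smul_mem_logForms₀Degree p)

/-- The sheaf on `ℙV` associated to the graded module `Ω^p_0(𝒜)`. -/
abbrev Arrangement.tilde : (Proj (grading ℓ)).Modules := (𝒜.tildeSections p).toModules

/-- The description of the sheaf `Ω^p(ℙ𝒜)` by its sections: the locally constant families of rational `p`-forms on `ℙV` that
lie in the stalk of `Ω^p(ℙ𝒜)` at each point. -/
def Arrangement.projLogSections : LocalSections (grading ℓ) where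
  N _ := ProjRatForms ℓ
  module x := inferInstanceAs (Module (LocalRingAt x) (ProjRatForms ℓ))
  ι := ProjRatForms ℓ
  Rel ω x z := ω ∈ 𝒜.projLogForms x p ∧ z = ω
  zero_rel := ⟨0, fun _ => ⟨zero_mem _, rfl⟩⟩
  add_rel := fun ω η => ⟨ω + η, fun _ _ _ h₁ h₂ => ⟨add_mem h₁.1 h₂.1, by rw [h₁.2, h₂.2]⟩⟩
  smul_rel := fun ω d a b => by
    by_cases hb0 : (b : CoordRing ℓ) = 0
    · exact ⟨0, fun x hb => absurd (hb0 ▸ zero_mem _) hb⟩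
    · let q : ProjRatFun ℓ := ⟨_, d, a, b, a.2, b.2, hb0, rfl⟩
      refine ⟨q • ω, fun x hb z hz => ?_⟩
      have hq : q • ω = (HomogeneousLocalization.mk ⟨d, a, b, hb⟩ : LocalRingAt x) • ω := by
        rw [← algebraMap_smul (ProjRatFun ℓ)
          (HomogeneousLocalization.mk ⟨d, a, b, hb⟩ : LocalRingAt x)]
        exact congrArg (fun t => t • ω) (Subtype.ext (algebraMap_mk x d a b hb).symm)
      rw [hq, hz.2]
      exact ⟨Submodule.smul_mem _ _ hz.1, rfl⟩

/-- The sheaf `Ω^p(ℙ𝒜)` of logarithmic `p`-forms along `ℙ𝒜`. -/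
abbrev Arrangement.projLogSheaf : (Proj (grading ℓ)).Modules := (𝒜.projLogSections p).toModules

/-- The canonical map `Ω^p_0(𝒜)_x → ⋀ Ω_{ℂ(V)/ℂ}`, `m / s ↦ s⁻¹ m`. -/
def Arrangement.fractionForm (x : ProjectiveSpectrum (grading ℓ)) :
    LocalizedModule x.asHomogeneousIdeal.toIdeal.primeCompl (𝒜.logForms₀ p) →ₗ[CoordRing ℓ]
      RatForms ℓ :=
  LocalizedModule.lift _ (𝒜.logForms₀ p).subtype fun s => by
    have hs : algebraMap (CoordRing ℓ) (RatFun ℓ) s ≠ 0 :=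
      (map_ne_zero_iff _ (IsFractionRing.injective _ _)).2 fun h => s.2 (h ▸ zero_mem _)
    rw [Module.End.isUnit_iff, Function.bijective_iff_has_inverse]
    refine ⟨fun ω => (algebraMap (CoordRing ℓ) (RatFun ℓ) s)⁻¹ • ω, fun ω => ?_, fun ω => ?_⟩ <;> beta_reduce
    · rw [Module.algebraMap_end_apply, ← algebraMap_smul (RatFun ℓ) (s : CoordRing ℓ), smul_smul,
        inv_mul_cancel₀ hs, one_smul]
    · rw [Module.algebraMap_end_apply, ← algebraMap_smul (RatFun ℓ) (s : CoordRing ℓ), smul_smul,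
        mul_inv_cancel₀ hs, one_smul]

end LogSheaves

end LogForms

end

/-! Both sheaves consist of families of rational forms. Since `π^*` is injective on rational
`p`-forms (`projPullback_eq_zero`), the theorem reduces to comparing conditions at each point inside
the rational forms on `V`. Three facts carry the comparison.

Descent. Functions of degree zero are killed by `χ`, so a pullback is annihilated by `ι_χ`
(`eulerContract_projPullback`); it is also homogeneous of degree `0`
(`projPullback_mem_homogeneousForms`). Conversely, the projection `m ↦ m - ⟨χ, m⟩ dx_i / x_i` of
`1`-forms induces `ω ↦ ω - dx_i / x_i ∧ ι_χ ω` on all forms (`map_eulerProj`). It fixes `ω` if `ι_χ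
ω = 0`, and it sends `dx_j` to `x_i d(x_j / x_i)`. Applied to the expansion of a homogeneous `ω` in
the `dx_j`, it exhibits `t⁻¹ ω`, with `t` homogeneous of the same degree, as a pullback
(`exists_projPullback_eq`).

Regularity. A rational `p`-form on `ℙV` is regular at `x` exactly if some homogeneous `t ∉ x` makes
`t` times its pullback polynomial (`mem_projForms_of_smul_mem`, `exists_smul_mem_of_mem_projForms`).

Poles. By Leibniz, `d(f ω) = ∑ f dα_H / α_H ∧ ω + f dω`. If `f ω` is polynomial, then `f dω` is
polynomial exactly if the sum is. The summand of `H` has at most the denominator `α_H`, and the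
`α_H` are pairwise non-associated primes, so poles of different summands cannot cancel: the sum is
polynomial exactly if every summand is (`Arrangement.extDiff_mem_of_mem_logForms`,
`Arrangement.mem_logForms_of_extDiff_mem`). The same Leibniz rule shows that the square of a
denominator absorbs its differential, which transports the condition on `dω` through `π^*`.

Regularity and polynomiality are tested on coefficients. Summing over all index maps `r`, not only
the increasing ones, costs a factor `p!`, which is invertible over `ℂ`. -/

open CategoryTheory TopologicalSpace TopCat Opposite AlgebraicGeometry
open scoped KaehlerDifferential

noncomputable section

namespace LogForms

/-! ### Morphisms of sheaves from partial linear maps between the modules of values -/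

section Sheaves

universe u

variable {R σ : Type u} [CommRing R] [SetLike σ R] [AddSubgroupClass σ R]

namespace LocalSections

variable {ℛ : ℕ → σ} [GradedRing ℛ]

/-- A family of partially defined linear maps between the modules of values which carries locally
given families to locally given families. -/
structure Transfer (S T : LocalSections ℛ) where
  /-- the graphs of the maps -/
  rel : ∀ x, S.N x → T.N x → Prop
  add : ∀ {x z z' w w'}, rel x z w → rel x z' w' → rel x (z + z') (w + w')
  smul : ∀ {x z w} (r : HomogeneousLocalization.AtPrime ℛ x.asHomogeneousIdeal.toIdeal),
    rel x z w → rel x (r • z) (r • w)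
  unique : ∀ {x z w w'}, rel x z w → rel x z w' → w = w'
  forth : ∀ {i x z}, S.Rel i x z → ∃ j, ∃ W : Opens (ProjectiveSpectrum ℛ), x ∈ W ∧
    ∀ y ∈ W, ∀ z, S.Rel i y z → ∃ w, T.Rel j y w ∧ rel y z w

namespace Transfer

variable {S T : LocalSections ℛ}

/-- The maps are only partial: the values of `Ω^p(ℙ𝒜)` lie in the space of all rational forms, most
of which are no fractions `m / t`. A value of a section is locally given by an index, and there
`forth` applies. -/
theorem exists_rel (φ : Transfer S T) {U : Opens (ProjectiveSpectrum ℛ)} (s : S.sections U) (x : U) :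
    ∃ w, φ.rel x (s.1 x) w := by
  obtain ⟨V, hxV, hVU, i, hi⟩ := s.2 x
  obtain ⟨j, W, hxW, hW⟩ := φ.forth (hi ⟨x.1, hxV⟩)
  obtain ⟨w, -, hw⟩ := hW x hxW _ (hi ⟨x.1, hxV⟩)
  exact ⟨w, hw⟩

variable (φ : Transfer S T)

/-- The map on families. -/
def family {U : Opens (ProjectiveSpectrum ℛ)} (s : S.sections U) (x : U) : T.N x :=
  (φ.exists_rel s x).choose

theorem rel_family {U : Opens (ProjectiveSpectrum ℛ)} (s : S.sections U) (x : U) :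
    φ.rel x (s.1 x) (φ.family s x) :=
  (φ.exists_rel s x).choose_spec

theorem isSection_family {U : Opens (ProjectiveSpectrum ℛ)} (s : S.sections U) :
    T.IsSection (φ.family s) := by
  intro x
  obtain ⟨V, hxV, hVU, i, hi⟩ := s.2 x
  obtain ⟨j, W, hxW, hW⟩ := φ.forth (hi ⟨x.1, hxV⟩)
  refine ⟨V ⊓ W, ⟨hxV, hxW⟩, inf_le_left.trans hVU, j, fun y => ?_⟩
  obtain ⟨w, hw, hr⟩ := hW y.1 y.2.2 _ (hi ⟨y.1, y.2.1⟩)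
  have e : φ.family s ⟨y.1, hVU y.2.1⟩ = w := φ.unique (φ.rel_family s ⟨y.1, hVU y.2.1⟩) hr
  exact e ▸ hw

/-- The map on sections. -/
def sectionMap (U : Opens (ProjectiveSpectrum ℛ)) : S.sections U →+ T.sections U where
  toFun s := ⟨φ.family s, φ.isSection_family s⟩
  map_zero' := by
    refine Subtype.ext (funext fun x => φ.unique (φ.rel_family 0 x) ?_)
    have h := φ.smul 0 (φ.rel_family 0 x)
    rw [zero_smul, zero_smul] at h
    exact h
  map_add' s t := Subtype.ext (funext fun x =>
    φ.unique (φ.rel_family _ x) (φ.add (φ.rel_family s x) (φ.rel_family t x)))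

theorem sectionMap_smul (U : Opens (ProjectiveSpectrum ℛ))
    (r : (ProjectiveSpectrum.Proj.structureSheaf ℛ).1.obj (op U)) (s : S.sections U) :
    φ.sectionMap U (r • s) = r • φ.sectionMap U s :=
  Subtype.ext (funext fun x =>
    φ.unique (φ.rel_family _ x) (φ.smul (sectionValue r x) (φ.rel_family s x)))

/-- The morphism of sheaves of modules. -/
def hom : S.toModules ⟶ T.toModules :=
  SheafOfModules.Hom.mk (PresheafOfModules.homMk (M₁ := S.toModules.val) (M₂ := T.toModules.val)
    { app := fun U => AddCommGrpCat.ofHom (φ.sectionMap U.unop)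
      naturality := fun U V i => by
        refine AddCommGrpCat.hom_ext (AddMonoidHom.ext fun s => Subtype.ext (funext fun x => ?_))
        exact φ.unique (φ.rel_family (U := V.unop) (S.presheafAb.map i s) x)
          (φ.rel_family (U := U.unop) s ⟨x.1, leOfHom i.unop x.2⟩) }
    fun U r s => φ.sectionMap_smul U.unop r s)

/-- This pins down the morphism, which is built by choice; the compatibility with `π^*` in the
theorem is read off from it. -/
theorem rel_value_hom {U : (Proj ℛ).Opens} (s : Γ(S.toModules, U)) (x : ProjectiveSpectrum ℛ)
    (hx : x ∈ U) : φ.rel x (S.value s x hx) (T.value (φ.hom.app U s) x hx) :=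
  φ.rel_family (U := U) s ⟨x, hx⟩

theorem section_ext {U : (Proj ℛ).Opens} {s t : Γ(S.toModules, U)}
    (h : ∀ x hx, S.value s x hx = S.value t x hx) : s = t :=
  Subtype.ext (p := fun t => t ∈ S.sections U) (funext fun x => h x.1 x.2)

/-- Mutually inverse transfers give an isomorphism. -/
def iso (ψ : Transfer T S) (h : ∀ x z w, φ.rel x z w ↔ ψ.rel x w z) :
    S.toModules ≅ T.toModules where
  hom := φ.hom
  inv := ψ.hom
  hom_inv_id := by
    ext U s
    refine section_ext fun x hx => ?_
    exact ψ.unique (ψ.rel_value_hom (φ.hom.app U s) x hx) ((h _ _ _).1 (φ.rel_value_hom s x hx))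
  inv_hom_id := by
    ext U s
    refine section_ext fun x hx => ?_
    exact φ.unique (φ.rel_value_hom (ψ.hom.app U s) x hx) ((h _ _ _).2 (ψ.rel_value_hom s x hx))

end Transfer

end LocalSections

end Sheaves

/-! ### Coefficients of exterior forms -/

section Coefficients

variable {k A : Type*} [CommRing k] [CommRing A] [Algebra k A] {n : Type*}

/-- The linear functional on forms with `m₁ ∧ ⋯ ∧ m_p ↦ det (δ_{r(i)} m_j)` for `1`-forms `mⱼ`,
which vanishes on `q`-forms for `q ≠ p`. -/
def coeff (δ : n → Module.Dual A Ω[A⁄k]) {p : ℕ} (r : Fin p → n) : Forms k A →ₗ[A] A :=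
  ExteriorAlgebra.liftAlternating (Pi.single p
    (Matrix.detRowAlternating.compLinearMap (LinearMap.pi fun i => δ (r i))))

theorem coeff_ιMulti (δ : n → Module.Dual A Ω[A⁄k]) {p : ℕ} (r : Fin p → n)
    (m : Fin p → Ω[A⁄k]) :
    coeff δ r (ExteriorAlgebra.ιMulti A p m) = Matrix.det (.of fun i j => δ (r j) (m i)) := by
  rw [coeff, ExteriorAlgebra.liftAlternating_apply_ιMulti, Pi.single_eq_same]
  rfl

/-- Expand every factor in the `v j`. Doing so for each permutation of the factors, with its sign,
gives `p!` copies of the same form, and the signed products add up to determinants. The `v j` need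
only span compatibly with `δ`; linear independence plays no role, so a redundant family such as all
`d(x_j / x_i)` is allowed. -/
theorem factorial_smul_ιMulti [Fintype n] (δ : n → Module.Dual A Ω[A⁄k]) (v : n → Ω[A⁄k])
    (hv : ∀ m, ∑ j, δ j m • v j = m) {p : ℕ} (m : Fin p → Ω[A⁄k]) :
    (p.factorial : A) • ExteriorAlgebra.ιMulti A p m =
      ∑ r : Fin p → n, coeff δ r (ExteriorAlgebra.ιMulti A p m) •
        ExteriorAlgebra.ιMulti A p (v ∘ r) := by
  classical
  have h (m : Fin p → Ω[A⁄k]) : ExteriorAlgebra.ιMulti A p m =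
      ∑ r : Fin p → n, (∏ i, δ (r i) (m i)) • ExteriorAlgebra.ιMulti A p (v ∘ r) := by
    conv_lhs => rw [← funext fun i => hv (m i)]
    change (ExteriorAlgebra.ιMulti A p).toMultilinearMap _ = _
    rw [MultilinearMap.map_sum]
    exact Finset.sum_congr rfl fun r _ => MultilinearMap.map_smul_univ _ _ _
  have h2 (σ : Equiv.Perm (Fin p)) : ExteriorAlgebra.ιMulti A p m =
      ∑ r : Fin p → n, ((Equiv.Perm.sign σ : ℤ) * ∏ i, δ (r i) (m (σ i))) •
        ExteriorAlgebra.ιMulti A p (v ∘ r) := by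
    have h3 := AlternatingMap.map_perm (ExteriorAlgebra.ιMulti A p) m σ
    have h4 := h (m ∘ σ)
    simp only [Function.comp_apply] at h4
    simp_rw [mul_smul, ← Finset.smul_sum]
    rw [← h4, h3, Units.smul_def, Int.cast_smul_eq_zsmul, smul_smul,
      ← Units.val_mul, Int.units_mul_self, Units.val_one, one_smul]
  have h4 := Finset.sum_congr (rfl : (Finset.univ : Finset (Equiv.Perm (Fin p))) = _)
    fun σ _ => h2 σ
  rw [Finset.sum_const, Finset.card_univ, Fintype.card_perm, Fintype.card_fin, Finset.sum_comm,
    ← Nat.cast_smul_eq_nsmul A] at h4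
  rw [h4]
  refine Finset.sum_congr rfl fun r _ => ?_
  rw [coeff_ιMulti, Matrix.det_apply', Finset.sum_smul]
  rfl

variable (k A) in
/-- The `A`-module of `p`-forms. -/
abbrev pForms (p : ℕ) : Submodule A (Forms k A) := regularForms k A A p

theorem factorial_smul_form [Fintype n] (δ : n → Module.Dual A Ω[A⁄k]) (v : n → Ω[A⁄k])
    (hv : ∀ m, ∑ j, δ j m • v j = m) {p : ℕ} {ω : Forms k A} (hω : ω ∈ pForms k A p) :
    (p.factorial : A) • ω =
      ∑ r : Fin p → n, coeff δ r ω • ExteriorAlgebra.ιMulti A p (v ∘ r) := by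
  induction hω using Submodule.span_induction with
  | zero => simp
  | add x y _ _ hx hy => simp only [smul_add, hx, hy, map_add, add_smul, Finset.sum_add_distrib]
  | smul c x _ hx =>
    rw [smul_comm, hx, Finset.smul_sum]
    simp only [map_smul, smul_smul, smul_eq_mul]
  | mem x hx =>
    obtain ⟨b, rfl⟩ := hx
    exact factorial_smul_ιMulti δ v hv _

end Coefficients

/-! ### Regular forms and the exterior derivative -/

section RegularForms

variable {k B K : Type*} [CommRing k] [CommRing B] [CommRing K] [Algebra k K] [Algebra B K]
  [SMulCommClass k B K]

theorem algebraMap_smul_forms (b : B) (ω : Forms k K) : algebraMap B K b • ω = b • ω :=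
  algebraMap_smul K b ω

theorem extDiff_ιMulti_D (p : ℕ) (b : Fin p → K) :
    extDiff k K (ExteriorAlgebra.ιMulti K p fun i => KaehlerDifferential.D k K (b i)) = 0 := by
  induction p with
  | zero =>
    have h := extDiff_algebraMap (k := k) (A := K) 1
    rw [map_one, ← map_one (algebraMap k K), dd_algebraMap] at h
    rw [ExteriorAlgebra.ιMulti_zero_apply, h]
  | succ p ih =>
    have h := ExteriorAlgebra.ιMulti_succ_apply (R := K)
      (fun i => KaehlerDifferential.D k K (b i))
    rw [h, extDiff_mul]
    have h' := ih (fun i => b i.succ)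
    have h2 : extDiff k K (ExteriorAlgebra.ι K (KaehlerDifferential.D k K (b 0))) = 0 :=
      extDiff_dd (b 0)
    rw [h2, zero_mul, zero_add]
    exact (congrArg _ h').trans (mul_zero _)

/-- The generators are closed, so only the differentials of the coefficients in `B` contribute. -/
theorem extDiff_mem_regularForms {p : ℕ} {ω : Forms k K} (hω : ω ∈ regularForms k B K p) :
    extDiff k K ω ∈ regularForms k B K (p + 1) := by
  induction hω using Submodule.span_induction with
  | zero => simp
  | add x y _ _ hx hy => rw [map_add]; exact add_mem hx hy
  | smul c x h hx =>
    rw [← algebraMap_smul_forms c, extDiff_smul, algebraMap_smul_forms]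
    exact add_mem (dd_mul_mem_regularForms c h) (Submodule.smul_mem _ _ hx)
  | mem x hx =>
    obtain ⟨b, rfl⟩ := hx
    rw [extDiff_ιMulti_D]
    exact zero_mem _

theorem regularForms_le_pForms {p : ℕ} {ω : Forms k K} (hω : ω ∈ regularForms k B K p) :
    ω ∈ pForms k K p := by
  induction hω using Submodule.span_induction with
  | zero => exact zero_mem _
  | add x y _ _ hx hy => exact add_mem hx hy
  | smul c x h hx =>
    rw [← algebraMap_smul_forms c]
    exact Submodule.smul_mem _ _ hx
  | mem x hx =>
    obtain ⟨b, rfl⟩ := hx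
    exact Submodule.subset_span ⟨fun i => algebraMap B K (b i), rfl⟩

end RegularForms

/-! ### Rational and polynomial forms on `V` in the coordinates `x_j` -/

section RationalFunctions

variable {ℓ : ℕ}

/-- The pairing of rational `1`-forms with a polynomial vector field. -/
def fieldPairing (δ : Derivation ℂ (CoordRing ℓ) (CoordRing ℓ)) :
    Module.Dual (RatFun ℓ) Ω[RatFun ℓ⁄ℂ] :=
  LinearMap.extendScalarsOfIsLocalization (nonZeroDivisors (CoordRing ℓ)) (RatFun ℓ)
    (IsLocalizedModule.lift (nonZeroDivisors (CoordRing ℓ))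
      (KaehlerDifferential.map ℂ ℂ (CoordRing ℓ) (RatFun ℓ))
      ((Algebra.linearMap (CoordRing ℓ) (RatFun ℓ)).comp δ.liftKaehlerDifferential)
      (IsLocalizedModule.map_units (Algebra.linearMap (CoordRing ℓ) (RatFun ℓ))))

theorem fieldPairing_D (δ : Derivation ℂ (CoordRing ℓ) (CoordRing ℓ)) (a : CoordRing ℓ) :
    fieldPairing δ (KaehlerDifferential.D ℂ (RatFun ℓ) (algebraMap (CoordRing ℓ) (RatFun ℓ) a)) =
      algebraMap (CoordRing ℓ) (RatFun ℓ) (δ a) := by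
  have h := IsLocalizedModule.lift_apply (nonZeroDivisors (CoordRing ℓ))
    (KaehlerDifferential.map ℂ ℂ (CoordRing ℓ) (RatFun ℓ))
    ((Algebra.linearMap (CoordRing ℓ) (RatFun ℓ)).comp δ.liftKaehlerDifferential)
    (IsLocalizedModule.map_units (Algebra.linearMap (CoordRing ℓ) (RatFun ℓ)))
    (KaehlerDifferential.D ℂ (CoordRing ℓ) a)
  rw [KaehlerDifferential.map_D] at h
  refine h.trans ?_
  rw [LinearMap.comp_apply, Derivation.liftKaehlerDifferential_comp_D, Algebra.linearMap_apply]

theorem eulerPairing_eq :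
    eulerPairing ℓ = fieldPairing (MvPolynomial.mkDerivation ℂ MvPolynomial.X) := rfl

/-- The pairing of rational `1`-forms with `∂_j`. -/
abbrev partialPairing (j : Fin ℓ) : Module.Dual (RatFun ℓ) Ω[RatFun ℓ⁄ℂ] :=
  fieldPairing (MvPolynomial.pderiv j)

/-- The rational `1`-form `dx_j`. -/
abbrev dX (j : Fin ℓ) : Ω[RatFun ℓ⁄ℂ] :=
  KaehlerDifferential.D ℂ (RatFun ℓ) (algebraMap (CoordRing ℓ) (RatFun ℓ) (MvPolynomial.X j))

/-- Two derivations of a field that agree on a subalgebra agree on its quotients. -/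
theorem derivation_div_eq {k F M : Type*} [CommRing k] [Field F] [Algebra k F] [AddCommGroup M]
    [Module k M] [Module F M] {D₁ D₂ : Derivation k F M} {a b : F} (ha : D₁ a = D₂ a)
    (hb : D₁ b = D₂ b) : D₁ (a / b) = D₂ (a / b) := by
  rw [Derivation.leibniz_div, Derivation.leibniz_div, ha, hb]

/-- A family of linear functionals which computes the differentials of a subset
that generates the field expands all `1`-forms. -/
theorem sum_smul_eq_of_D {k F : Type*} [CommRing k] [Field F] [Algebra k F] {n : Type*}
    [Fintype n] (δ : n → Module.Dual F Ω[F⁄k]) (v : n → Ω[F⁄k]) (s : Set F)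
    (hs : ∀ z, ∃ a ∈ Algebra.adjoin k s, ∃ b ∈ Algebra.adjoin k s, z = a / b)
    (h : ∀ a ∈ s, ∑ j, δ j (KaehlerDifferential.D k F a) • v j = KaehlerDifferential.D k F a)
    (m : Ω[F⁄k]) : ∑ j, δ j m • v j = m := by
  let φ : Ω[F⁄k] →ₗ[F] Ω[F⁄k] := ∑ j, (δ j).smulRight (v j)
  have hφ (m : Ω[F⁄k]) : φ m = ∑ j, δ j m • v j := by simp [φ, LinearMap.sum_apply]
  -- The candidate expansion composed with `D` is again a derivation, so it has to be compared with
  -- `D` on generators only; the quotient rule then covers the field.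
  have h1 : Set.EqOn (φ.compDer (KaehlerDifferential.D k F)) (KaehlerDifferential.D k F)
      (Algebra.adjoin k s) :=
    Derivation.eqOn_adjoin fun a ha => (hφ _).trans (h a ha)
  have h2 : φ.compDer (KaehlerDifferential.D k F) = KaehlerDifferential.D k F := by
    ext z
    obtain ⟨a, ha, b, hb, rfl⟩ := hs z
    exact derivation_div_eq (h1 ha) (h1 hb)
  rw [← hφ]
  have hm : m ∈ Submodule.span F (Set.range (KaehlerDifferential.D k F)) := by
    rw [KaehlerDifferential.span_range_derivation]; trivial
  induction hm using Submodule.span_induction with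
  | zero => simp
  | add x y _ _ hx hy => rw [map_add, hx, hy]
  | smul c x _ hx => rw [map_smul, hx]
  | mem x hx =>
    obtain ⟨a, rfl⟩ := hx
    exact congrArg (fun D => D a) h2

theorem exists_adjoin_X (z : RatFun ℓ) :
    ∃ a ∈ Algebra.adjoin ℂ (Set.range fun j : Fin ℓ =>
        algebraMap (CoordRing ℓ) (RatFun ℓ) (MvPolynomial.X j)),
      ∃ b ∈ Algebra.adjoin ℂ (Set.range fun j : Fin ℓ =>
        algebraMap (CoordRing ℓ) (RatFun ℓ) (MvPolynomial.X j)), z = a / b := by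
  have h (a : CoordRing ℓ) : algebraMap (CoordRing ℓ) (RatFun ℓ) a ∈
      Algebra.adjoin ℂ (Set.range fun j : Fin ℓ =>
        algebraMap (CoordRing ℓ) (RatFun ℓ) (MvPolynomial.X j)) := by
    have ha : a ∈ Algebra.adjoin ℂ (Set.range (MvPolynomial.X : Fin ℓ → CoordRing ℓ)) := by
      rw [MvPolynomial.adjoin_range_X]; trivial
    have h2 := (AlgHom.map_adjoin (IsScalarTower.toAlgHom ℂ (CoordRing ℓ) (RatFun ℓ))
      (Set.range MvPolynomial.X)).le ⟨a, ha, rfl⟩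
    rw [← Set.range_comp] at h2
    exact h2
  obtain ⟨a, b, -, rfl⟩ := IsFractionRing.div_surjective (A := CoordRing ℓ) z
  exact ⟨_, h a, _, h b, rfl⟩

theorem sum_partialPairing_smul (m : Ω[RatFun ℓ⁄ℂ]) : ∑ j, partialPairing j m • dX j = m := by
  refine sum_smul_eq_of_D _ _ _ exists_adjoin_X ?_ m
  rintro _ ⟨i, rfl⟩
  simp only [fieldPairing_D, MvPolynomial.pderiv_X]
  rw [Finset.sum_eq_single i]
  · simp
  · intro j _ hj
    rw [Pi.single_eq_of_ne (Ne.symm hj), map_zero, zero_smul]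
  · simp

/-- The coefficients of a rational form, with respect to the products of the `dx_j`. -/
abbrev ratCoeff {p : ℕ} (r : Fin p → Fin ℓ) : RatForms ℓ →ₗ[RatFun ℓ] RatFun ℓ :=
  coeff partialPairing r

theorem factorial_smul_ratForm {p : ℕ} {ω : RatForms ℓ} (hω : ω ∈ pForms ℂ (RatFun ℓ) p) :
    (p.factorial : RatFun ℓ) • ω =
      ∑ r : Fin p → Fin ℓ, ratCoeff r ω • ExteriorAlgebra.ιMulti (RatFun ℓ) p fun i => dX (r i) :=
  factorial_smul_form _ _ sum_partialPairing_smul hω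

theorem algebraMap_ne_zero {a : CoordRing ℓ} (ha : a ≠ 0) :
    algebraMap (CoordRing ℓ) (RatFun ℓ) a ≠ 0 :=
  (map_ne_zero_iff _ (IsFractionRing.injective _ _)).2 ha

theorem ιMulti_dX_mem_polyForms {p : ℕ} (r : Fin p → Fin ℓ) :
    ExteriorAlgebra.ιMulti (RatFun ℓ) p (fun i => dX (r i)) ∈ polyForms ℓ p :=
  Submodule.subset_span ⟨fun i => MvPolynomial.X (r i), rfl⟩

/-- The coefficients of `db₁ ∧ ⋯ ∧ db_p` are the Jacobian minors of the polynomials `bᵢ`. -/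
theorem ratCoeff_mem_range {p : ℕ} {ω : RatForms ℓ} (hω : ω ∈ polyForms ℓ p)
    (r : Fin p → Fin ℓ) : ∃ a : CoordRing ℓ, ratCoeff r ω = algebraMap _ _ a := by
  induction hω using Submodule.span_induction with
  | zero => exact ⟨0, by simp⟩
  | add x y _ _ hx hy =>
    obtain ⟨a, ha⟩ := hx
    obtain ⟨b, hb⟩ := hy
    exact ⟨a + b, by rw [map_add, map_add, ha, hb]⟩
  | smul c x _ hx =>
    obtain ⟨a, ha⟩ := hx
    exact ⟨c * a, by rw [← algebraMap_smul_forms c, map_smul, ha, map_mul, smul_eq_mul]⟩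
  | mem x hx =>
    obtain ⟨b, rfl⟩ := hx
    refine ⟨Matrix.det (.of fun i j => MvPolynomial.pderiv (r j) (b i)), ?_⟩
    rw [coeff_ιMulti, RingHom.map_det]
    congr 1
    ext i j
    exact fieldPairing_D _ _

theorem factorial_ne_zero (p : ℕ) : (p.factorial : ℂ) ≠ 0 :=
  Nat.cast_ne_zero.2 p.factorial_ne_zero

theorem mem_polyForms_of_factorial {p : ℕ} {ω : RatForms ℓ}
    (h : (p.factorial : RatFun ℓ) • ω ∈ polyForms ℓ p) : ω ∈ polyForms ℓ p := by
  have h1 := Submodule.smul_mem _ (algebraMap ℂ (CoordRing ℓ) (p.factorial : ℂ)⁻¹) h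
  rwa [← algebraMap_smul_forms, smul_smul, ← IsScalarTower.algebraMap_apply,
    ← map_natCast (algebraMap ℂ (RatFun ℓ)), ← map_mul, inv_mul_cancel₀ (factorial_ne_zero p),
    map_one, one_smul] at h1

/-- Converse to `ratCoeff_mem_range`. That `ω` is a `p`-form has to be assumed, because the
coefficients do not see the other degrees. -/
theorem mem_polyForms_of_ratCoeff {p : ℕ} {ω : RatForms ℓ} (hω : ω ∈ pForms ℂ (RatFun ℓ) p)
    (h : ∀ r : Fin p → Fin ℓ, ∃ a : CoordRing ℓ, ratCoeff r ω = algebraMap _ _ a) :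
    ω ∈ polyForms ℓ p := by
  refine mem_polyForms_of_factorial ?_
  rw [factorial_smul_ratForm hω]
  refine sum_mem fun r _ => ?_
  obtain ⟨a, ha⟩ := h r
  rw [ha, algebraMap_smul_forms]
  exact Submodule.smul_mem _ _ (ιMulti_dX_mem_polyForms r)

end RationalFunctions

/-! ### Rational forms on `ℙV` in the chart `x_i ≠ 0`, and their pullback -/

section ProjectiveForms

variable {ℓ : ℕ}

/-- The fraction `a / b` of homogeneous polynomials of the same degree as an element of `ℂ(ℙV)`. -/
def projFrac {m : ℕ} (a b : CoordRing ℓ) (ha : a ∈ grading ℓ m) (hb : b ∈ grading ℓ m)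
    (hb0 : b ≠ 0) : ProjRatFun ℓ :=
  ⟨_, m, a, b, ha, hb, hb0, rfl⟩

theorem algebraMap_projFrac {m : ℕ} (a b : CoordRing ℓ) (ha : a ∈ grading ℓ m)
    (hb : b ∈ grading ℓ m) (hb0 : b ≠ 0) :
    algebraMap (ProjRatFun ℓ) (RatFun ℓ) (projFrac a b ha hb hb0) =
      algebraMap _ _ a / algebraMap _ _ b := rfl

theorem exists_eq_projFrac (z : ProjRatFun ℓ) : ∃ (m : ℕ) (a b : CoordRing ℓ)
    (ha : a ∈ grading ℓ m) (hb : b ∈ grading ℓ m) (hb0 : b ≠ 0), z = projFrac a b ha hb hb0 := by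
  obtain ⟨_, m, a, b, ha, hb, hb0, rfl⟩ := z
  exact ⟨m, a, b, ha, hb, hb0, rfl⟩

theorem algebraMap_proj_injective :
    Function.Injective (algebraMap (ProjRatFun ℓ) (RatFun ℓ)) :=
  (algebraMap (ProjRatFun ℓ) (RatFun ℓ)).injective

theorem X_mem_grading (i : Fin ℓ) : (MvPolynomial.X i : CoordRing ℓ) ∈ grading ℓ 1 :=
  MvPolynomial.isHomogeneous_X ℂ i

theorem algebraMap_X_ne_zero (i : Fin ℓ) :
    algebraMap (CoordRing ℓ) (RatFun ℓ) (MvPolynomial.X i) ≠ 0 :=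
  algebraMap_ne_zero (MvPolynomial.X_ne_zero i)

theorem X_mul_pderiv_mem {m : ℕ} {a : CoordRing ℓ} (ha : a ∈ grading ℓ m) (i j : Fin ℓ) :
    MvPolynomial.X i * MvPolynomial.pderiv j a ∈ grading ℓ m := by
  -- The partial derivative has degree `m - 1`, truncated at `m = 0`; there `a` is a constant and
  -- its derivative vanishes.
  cases m with
  | zero =>
    have h : a = MvPolynomial.C (a.coeff 0) :=
      MvPolynomial.totalDegree_eq_zero_iff_eq_C.1
        (Nat.le_zero.1 (MvPolynomial.IsHomogeneous.totalDegree_le ha))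
    rw [h, MvPolynomial.pderiv_C, mul_zero]
    exact zero_mem _
  | succ m =>
    have := SetLike.mul_mem_graded (X_mem_grading i) (MvPolynomial.IsHomogeneous.pderiv (i := j) ha)
    rwa [Nat.add_sub_cancel, add_comm] at this

/-- The field `∂_j` lowers the degree by one and `x_i` restores it, so `x_i ∂_j` acts on fractions
of degree zero; the quotient rule gives the explicit fraction with denominator `b²`. -/
theorem X_mul_partial_mem (i j : Fin ℓ) (z : ProjRatFun ℓ) :
    algebraMap (CoordRing ℓ) (RatFun ℓ) (MvPolynomial.X i) *
      partialPairing j (KaehlerDifferential.D ℂ (RatFun ℓ) (algebraMap _ (RatFun ℓ) z)) ∈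
        homogeneousFractions ℓ := by
  obtain ⟨m, a, b, ha, hb, hb0, rfl⟩ := exists_eq_projFrac z
  refine ⟨m + m, b * (MvPolynomial.X i * MvPolynomial.pderiv j a) -
    a * (MvPolynomial.X i * MvPolynomial.pderiv j b), b * b, ?_, SetLike.mul_mem_graded hb hb,
    mul_ne_zero hb0 hb0, ?_⟩
  · exact sub_mem (SetLike.mul_mem_graded hb (X_mul_pderiv_mem ha i j))
      (SetLike.mul_mem_graded ha (X_mul_pderiv_mem hb i j))
  · have hb0' := algebraMap_ne_zero hb0
    rw [algebraMap_projFrac, Derivation.leibniz_div, map_smul, map_sub, map_smul, map_smul,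
      fieldPairing_D, fieldPairing_D]
    simp only [smul_eq_mul, map_sub, map_mul]
    field_simp

/-- The rational function `x_i ∂_j z`. -/
def xPartial (i j : Fin ℓ) (z : ProjRatFun ℓ) : ProjRatFun ℓ := ⟨_, X_mul_partial_mem i j z⟩

theorem algebraMap_xPartial (i j : Fin ℓ) (z : ProjRatFun ℓ) :
    algebraMap _ (RatFun ℓ) (xPartial i j z) =
      algebraMap (CoordRing ℓ) (RatFun ℓ) (MvPolynomial.X i) *
      partialPairing j (KaehlerDifferential.D ℂ (RatFun ℓ) (algebraMap _ (RatFun ℓ) z)) := rfl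

/-- The derivation `x_i ∂_j` of `ℂ(ℙV)`. -/
def chartDerivation (i j : Fin ℓ) : Derivation ℂ (ProjRatFun ℓ) (ProjRatFun ℓ) :=
  Derivation.mk'
    { toFun := xPartial i j
      map_add' := fun a b => algebraMap_proj_injective (by
        simp only [map_add, algebraMap_xPartial, mul_add])
      map_smul' := fun c a => algebraMap_proj_injective (by
        rw [RingHom.id_apply, Algebra.smul_def, Algebra.smul_def, map_mul, algebraMap_xPartial,
          map_mul, ← IsScalarTower.algebraMap_apply, Derivation.leibniz,
          Derivation.map_algebraMap, smul_zero, add_zero, map_smul, algebraMap_xPartial,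
          smul_eq_mul, mul_left_comm]) }
    fun a b => algebraMap_proj_injective (by
      rw [LinearMap.coe_mk, AddHom.coe_mk, map_add, smul_eq_mul, smul_eq_mul,
        (algebraMap (ProjRatFun ℓ) (RatFun ℓ)).map_mul,
        (algebraMap (ProjRatFun ℓ) (RatFun ℓ)).map_mul, algebraMap_xPartial, algebraMap_xPartial,
        algebraMap_xPartial, map_mul, Derivation.leibniz, map_add, map_smul, map_smul, smul_eq_mul,
        smul_eq_mul]
      ring)

theorem algebraMap_chartDerivation (i j : Fin ℓ) (z : ProjRatFun ℓ) :
    algebraMap _ (RatFun ℓ) (chartDerivation i j z) =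
      algebraMap (CoordRing ℓ) (RatFun ℓ) (MvPolynomial.X i) *
      partialPairing j (KaehlerDifferential.D ℂ (RatFun ℓ) (algebraMap _ (RatFun ℓ) z)) := rfl

/-- The pairing of rational `1`-forms on `ℙV` with `x_i ∂_j`. -/
abbrev chartPairing (i j : Fin ℓ) : Module.Dual (ProjRatFun ℓ) Ω[ProjRatFun ℓ⁄ℂ] :=
  (chartDerivation i j).liftKaehlerDifferential

variable (ℓ) in
/-- The pullback of rational `1`-forms. -/
abbrev pullbackΩ : Ω[ProjRatFun ℓ⁄ℂ] →ₗ[ProjRatFun ℓ] Ω[RatFun ℓ⁄ℂ] :=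
  KaehlerDifferential.map ℂ ℂ (ProjRatFun ℓ) (RatFun ℓ)

theorem Ω_induction {k F : Type*} [CommRing k] [CommRing F] [Algebra k F]
    {P : Ω[F⁄k] → Prop} (zero : P 0) (add : ∀ x y, P x → P y → P (x + y))
    (smul : ∀ (c : F) x, P x → P (c • x)) (D : ∀ a, P (KaehlerDifferential.D k F a)) (m) : P m := by
  have hm : m ∈ Submodule.span F (Set.range (KaehlerDifferential.D k F)) := by
    rw [KaehlerDifferential.span_range_derivation]; trivial
  induction hm using Submodule.span_induction with
  | zero => exact zero
  | add x y _ _ hx hy => exact add x y hx hy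
  | smul c x _ hx => exact smul c x hx
  | mem x hx =>
    obtain ⟨a, rfl⟩ := hx
    exact D a

theorem algebraMap_chartPairing (i j : Fin ℓ) (m : Ω[ProjRatFun ℓ⁄ℂ]) :
    algebraMap _ (RatFun ℓ) (chartPairing i j m) =
      algebraMap (CoordRing ℓ) (RatFun ℓ) (MvPolynomial.X i) *
        partialPairing j (pullbackΩ ℓ m) := by
  induction m using Ω_induction with
  | zero => simp
  | add x y hx hy => rw [map_add, map_add, hx, hy, map_add, map_add, mul_add]
  | smul c x hx =>
    rw [map_smul, smul_eq_mul, map_mul, hx, map_smul, ← algebraMap_smul (RatFun ℓ) c, map_smul,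
      smul_eq_mul]
    ring
  | D a =>
    rw [Derivation.liftKaehlerDifferential_comp_D, KaehlerDifferential.map_D,
      algebraMap_chartDerivation]

/-- The coordinate function `x_j / x_i` on `ℙV`. -/
def chartFun (i j : Fin ℓ) : ProjRatFun ℓ :=
  projFrac (MvPolynomial.X j) (MvPolynomial.X i) (X_mem_grading j) (X_mem_grading i)
    (MvPolynomial.X_ne_zero i)

/-- The rational `1`-form `d (x_j / x_i)` on `ℙV`. -/
abbrev dchart (i j : Fin ℓ) : Ω[ProjRatFun ℓ⁄ℂ] :=
  KaehlerDifferential.D ℂ (ProjRatFun ℓ) (chartFun i j)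

theorem chartFun_self (i : Fin ℓ) : chartFun i i = 1 :=
  algebraMap_proj_injective (by
    rw [chartFun, algebraMap_projFrac, div_self (algebraMap_X_ne_zero i), map_one])

/-- Dehomogenization, monomial by monomial: each variable `x_j` equals `x_i (x_j / x_i)`, and a
monomial of degree `m` collects `m` factors `x_i`. -/
theorem algebraMap_eq_pow_mul (i : Fin ℓ) {m : ℕ} {a : CoordRing ℓ} (ha : a ∈ grading ℓ m) :
    algebraMap (CoordRing ℓ) (RatFun ℓ) a =
      algebraMap (CoordRing ℓ) (RatFun ℓ) (MvPolynomial.X i) ^ m *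
        algebraMap _ (RatFun ℓ) (MvPolynomial.aeval (chartFun i) a) := by
  have hX := algebraMap_X_ne_zero i
  rw [MvPolynomial.as_sum a]
  simp only [map_sum, Finset.mul_sum]
  refine Finset.sum_congr rfl fun s hs => ?_
  have hd : ∑ j, s j = m := by
    rw [← ha (MvPolynomial.mem_support_iff.1 hs), Finsupp.weight_apply, Finsupp.sum_fintype _ _ (by simp)]
    simp
  rw [MvPolynomial.aeval_monomial, MvPolynomial.monomial_eq, map_mul, map_mul,
    Finsupp.prod_fintype _ _ (by simp), Finsupp.prod_fintype _ _ (by simp), map_prod, map_prod,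
    ← hd, ← Finset.prod_pow_eq_pow_sum, mul_left_comm, ← Finset.prod_mul_distrib]
  have h1 : algebraMap (CoordRing ℓ) (RatFun ℓ) (MvPolynomial.C (a.coeff s)) =
      algebraMap (ProjRatFun ℓ) (RatFun ℓ) (algebraMap ℂ _ (a.coeff s)) := by
    rw [← IsScalarTower.algebraMap_apply, ← MvPolynomial.algebraMap_eq,
      ← IsScalarTower.algebraMap_apply]
  rw [h1]
  congr 1
  refine Finset.prod_congr rfl fun j _ => ?_
  rw [map_pow, map_pow, ← mul_pow, chartFun, algebraMap_projFrac, mul_div_cancel₀ _ hX]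

theorem exists_adjoin_chartFun (i : Fin ℓ) (z : ProjRatFun ℓ) :
    ∃ a ∈ Algebra.adjoin ℂ (Set.range (chartFun i)),
      ∃ b ∈ Algebra.adjoin ℂ (Set.range (chartFun i)), z = a / b := by
  obtain ⟨m, a, b, ha, hb, hb0, rfl⟩ := exists_eq_projFrac z
  have h (a : CoordRing ℓ) : MvPolynomial.aeval (chartFun i) a ∈
      Algebra.adjoin ℂ (Set.range (chartFun i)) := by
    rw [Algebra.adjoin_range_eq_range_aeval]
    exact ⟨a, rfl⟩
  refine ⟨_, h a, _, h b, algebraMap_proj_injective ?_⟩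
  rw [algebraMap_projFrac, map_div₀, algebraMap_eq_pow_mul i ha, algebraMap_eq_pow_mul i hb,
    mul_div_mul_left _ _ (pow_ne_zero _ (algebraMap_X_ne_zero i))]

theorem chartPairing_dchart (i j k : Fin ℓ) : chartPairing i j (dchart i k) =
    (if j = k then 1 else 0) - chartFun i k * (if j = i then 1 else 0) := by
  refine algebraMap_proj_injective ?_
  have hX := algebraMap_X_ne_zero i
  rw [algebraMap_chartPairing, KaehlerDifferential.map_D, chartFun, algebraMap_projFrac,
    Derivation.leibniz_div, map_smul, map_sub, map_smul, map_smul, fieldPairing_D, fieldPairing_D,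
    MvPolynomial.pderiv_X, MvPolynomial.pderiv_X, map_sub, map_mul, algebraMap_projFrac]
  simp only [smul_eq_mul, Pi.single_apply, apply_ite (algebraMap _ (RatFun ℓ)), map_one, map_zero,
    @eq_comm _ k, @eq_comm _ i]
  field_simp

/-- The pairings are not quite dual to the `d(x_j / x_i)`: there is a correction for `j = i`. It is
harmless, being multiplied by `d(x_i / x_i) = 0`, so the sum may run over all `j`. -/
theorem sum_chartPairing_smul (i : Fin ℓ) (m : Ω[ProjRatFun ℓ⁄ℂ]) :
    ∑ j, chartPairing i j m • dchart i j = m := by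
  refine sum_smul_eq_of_D _ _ _ (exists_adjoin_chartFun i) ?_ m
  rintro _ ⟨k, rfl⟩
  have h0 : dchart i i = 0 := by rw [dchart, chartFun_self, Derivation.map_one_eq_zero]
  have h (j : Fin ℓ) : chartPairing i j (dchart i k) • dchart i j =
      (if j = k then dchart i j else 0) := by
    rw [chartPairing_dchart]
    split_ifs with h1 h2 h2
    · rw [h2, h0, smul_zero]
    · rw [mul_zero, sub_zero, one_smul]
    · rw [h2, h0, smul_zero]
    · rw [mul_zero, sub_zero, zero_smul]
  rw [Finset.sum_congr rfl fun j _ => h j, Finset.sum_ite_eq' Finset.univ k]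
  simp

/-- The coefficients of a rational form on `ℙV`. -/
abbrev projCoeff (i : Fin ℓ) {p : ℕ} (r : Fin p → Fin ℓ) :
    ProjRatForms ℓ →ₗ[ProjRatFun ℓ] ProjRatFun ℓ :=
  coeff (chartPairing i) r

theorem factorial_smul_projForm (i : Fin ℓ) {p : ℕ} {ω : ProjRatForms ℓ}
    (hω : ω ∈ pForms ℂ (ProjRatFun ℓ) p) :
    (p.factorial : ProjRatFun ℓ) • ω = ∑ r : Fin p → Fin ℓ,
      projCoeff i r ω • ExteriorAlgebra.ιMulti (ProjRatFun ℓ) p fun k => dchart i (r k) :=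
  factorial_smul_form _ _ (sum_chartPairing_smul i) hω

theorem projPullback_ι (m : Ω[ProjRatFun ℓ⁄ℂ]) :
    projPullback ℓ (ExteriorAlgebra.ι _ m) = ExteriorAlgebra.ι _ (pullbackΩ ℓ m) := by
  rw [projPullback, ExteriorAlgebra.lift_ι_apply]
  rfl

theorem projPullback_ιMulti {p : ℕ} (m : Fin p → Ω[ProjRatFun ℓ⁄ℂ]) :
    projPullback ℓ (ExteriorAlgebra.ιMulti _ p m) =
      ExteriorAlgebra.ιMulti _ p fun i => pullbackΩ ℓ (m i) := by
  rw [ExteriorAlgebra.ιMulti_apply, ExteriorAlgebra.ιMulti_apply, map_list_prod, List.map_ofFn]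
  congr 2
  funext i
  exact projPullback_ι _

theorem projPullback_smul (c : ProjRatFun ℓ) (ω : ProjRatForms ℓ) :
    projPullback ℓ (c • ω) = algebraMap _ (RatFun ℓ) c • projPullback ℓ ω := by
  rw [map_smul, algebraMap_smul]

/-- The chart pairing is `x_i` times the pairing with `∂_j`, and a coefficient of a `p`-form is a `p
× p` determinant of such pairings. -/
theorem algebraMap_projCoeff (i : Fin ℓ) {p : ℕ} (r : Fin p → Fin ℓ) {ω : ProjRatForms ℓ}
    (hω : ω ∈ pForms ℂ (ProjRatFun ℓ) p) :
    algebraMap _ (RatFun ℓ) (projCoeff i r ω) =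
      algebraMap (CoordRing ℓ) (RatFun ℓ) (MvPolynomial.X i) ^ p *
        ratCoeff r (projPullback ℓ ω) := by
  induction hω using Submodule.span_induction with
  | zero => simp
  | add x y _ _ hx hy => rw [map_add, map_add, hx, hy, map_add, map_add, mul_add]
  | smul c x _ hx =>
    rw [projPullback_smul, LinearMap.map_smul, LinearMap.map_smul, smul_eq_mul, map_mul, hx,
      smul_eq_mul]
    ring
  | mem x hx =>
    obtain ⟨b, rfl⟩ := hx
    rw [projPullback_ιMulti, coeff_ιMulti, coeff_ιMulti, RingHom.map_det]
    have h := Matrix.det_smul (.of fun k l => partialPairing (r l) (pullbackΩ ℓ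
      (KaehlerDifferential.D ℂ (ProjRatFun ℓ) (algebraMap (ProjRatFun ℓ) _ (b k)))))
      (algebraMap (CoordRing ℓ) (RatFun ℓ) (MvPolynomial.X i))
    rw [Fintype.card_fin] at h
    rw [← h]
    congr 1
    ext k l
    rw [RingHom.mapMatrix_apply, Matrix.map_apply, Matrix.smul_apply, Matrix.of_apply,
      Matrix.of_apply, smul_eq_mul, algebraMap_chartPairing]

theorem projPullback_mem_pForms {p : ℕ} {ω : ProjRatForms ℓ}
    (hω : ω ∈ pForms ℂ (ProjRatFun ℓ) p) : projPullback ℓ ω ∈ pForms ℂ (RatFun ℓ) p := by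
  induction hω using Submodule.span_induction with
  | zero => rw [map_zero]; exact zero_mem _
  | add x y _ _ hx hy => rw [map_add]; exact add_mem hx hy
  | smul c x _ hx => rw [projPullback_smul]; exact Submodule.smul_mem _ _ hx
  | mem x hx =>
    obtain ⟨b, rfl⟩ := hx
    rw [projPullback_ιMulti]
    refine Submodule.subset_span ⟨fun i => algebraMap _ (RatFun ℓ) (b i), ?_⟩
    simp only [KaehlerDifferential.map_D]
    rfl

theorem factorial_ne_zero' {F : Type*} [Field F] [Algebra ℂ F] (p : ℕ) : (p.factorial : F) ≠ 0 := by
  rw [← map_natCast (algebraMap ℂ F)]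
  exact (map_ne_zero _).2 (factorial_ne_zero p)

/-- The coefficients of `ω` are those of its pullback up to the factor `x_i ^ p`, and they determine
`ω`. -/
theorem projPullback_eq_zero (i : Fin ℓ) {p : ℕ} {ω : ProjRatForms ℓ}
    (hω : ω ∈ pForms ℂ (ProjRatFun ℓ) p) (h : projPullback ℓ ω = 0) : ω = 0 := by
  have h1 := factorial_smul_projForm i hω
  have h2 (r : Fin p → Fin ℓ) : projCoeff i r ω = 0 := algebraMap_proj_injective (by
    rw [algebraMap_projCoeff i r hω, h, map_zero, mul_zero, map_zero])
  simp only [h2, zero_smul, Finset.sum_const_zero] at h1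
  exact (smul_eq_zero.1 h1).resolve_left (factorial_ne_zero' p)

end ProjectiveForms

/-! ### The Euler field, and descent of forms from `V` to `ℙV` -/

section Descent

variable {ℓ : ℕ}

theorem projPullback_involute (ω : ProjRatForms ℓ) :
    projPullback ℓ (CliffordAlgebra.involute ω) = CliffordAlgebra.involute (projPullback ℓ ω) := by
  induction ω using ExteriorAlgebra.induction with
  | algebraMap r =>
    rw [AlgHom.commutes, AlgHom.commutes,
      IsScalarTower.algebraMap_apply (ProjRatFun ℓ) (RatFun ℓ) (RatForms ℓ), AlgHom.commutes]
  | ι m =>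
    rw [CliffordAlgebra.involute_ι, map_neg, projPullback_ι, CliffordAlgebra.involute_ι]
  | mul a b ha hb => rw [map_mul, map_mul, ha, hb, map_mul, map_mul]
  | add a b ha hb => rw [map_add, map_add, ha, hb, map_add, map_add]

theorem projPullback_algebraMap (z : ProjRatFun ℓ) :
    projPullback ℓ (algebraMap _ _ z) = algebraMap (RatFun ℓ) _ (algebraMap _ (RatFun ℓ) z) := by
  rw [AlgHom.commutes, IsScalarTower.algebraMap_apply (ProjRatFun ℓ) (RatFun ℓ) (RatForms ℓ)]

theorem projPullback_dd (z : ProjRatFun ℓ) :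
    projPullback ℓ (dd ℂ _ z) = dd ℂ (RatFun ℓ) (algebraMap _ (RatFun ℓ) z) := by
  rw [projPullback_ι, KaehlerDifferential.map_D]

theorem projPullback_extDiff (ω : ProjRatForms ℓ) :
    projPullback ℓ (extDiff ℂ _ ω) = extDiff ℂ _ (projPullback ℓ ω) := by
  induction ω using ExteriorAlgebra.induction with
  | algebraMap r =>
    rw [projPullback_algebraMap, extDiff_algebraMap, extDiff_algebraMap, projPullback_dd]
  | ι m =>
    induction m using Ω_induction with
    | zero => simp
    | add x y hx hy => simp only [map_add, hx, hy]
    | smul c x hx =>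
      rw [map_smul, extDiff_smul, projPullback_smul, extDiff_smul, map_add, map_mul,
        projPullback_dd, projPullback_smul, hx]
    | D a =>
      have h := projPullback_dd a
      rw [dd] at h
      rw [h, extDiff_dd, map_zero, extDiff_dd]
  | mul a b ha hb =>
    rw [extDiff_mul, map_add, map_mul, map_mul, map_mul, extDiff_mul, ha, hb,
      projPullback_involute]
  | add a b ha hb => simp only [map_add, ha, hb]

theorem eulerPairing_of_homogeneous {m : ℕ} {a : CoordRing ℓ} (ha : a ∈ grading ℓ m) :
    eulerPairing ℓ (KaehlerDifferential.D ℂ (RatFun ℓ) (algebraMap _ (RatFun ℓ) a)) =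
      m * algebraMap _ (RatFun ℓ) a := by
  have hs (b : CoordRing ℓ) :
      (∑ j : Fin ℓ, (MvPolynomial.X j : CoordRing ℓ) •
        (MvPolynomial.pderiv j : Derivation ℂ (CoordRing ℓ) (CoordRing ℓ))) b =
        ∑ j : Fin ℓ, MvPolynomial.X j * MvPolynomial.pderiv j b :=
    (congrFun (map_sum (Derivation.coeFnAddMonoidHom (R := ℂ) (A := CoordRing ℓ)
      (M := CoordRing ℓ)) _ _) b).trans (Finset.sum_apply _ _ _)
  -- The derivation with `x_i ↦ x_i` is `∑ x_j ∂_j`, so that Euler's identity applies to it.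
  have h : MvPolynomial.mkDerivation ℂ MvPolynomial.X =
      ∑ j : Fin ℓ, (MvPolynomial.X j : CoordRing ℓ) •
        (MvPolynomial.pderiv j : Derivation ℂ (CoordRing ℓ) (CoordRing ℓ)) :=
    MvPolynomial.derivation_ext fun i => by
      rw [hs]
      simp [MvPolynomial.pderiv_X, Pi.single_apply]
  rw [eulerPairing_eq, fieldPairing_D, h, hs]
  rw [MvPolynomial.IsHomogeneous.sum_X_mul_pderiv ha, nsmul_eq_mul, map_mul, map_natCast]

/-- By Euler's identity and the quotient rule, `χ(a / b) = 0` if `a` and `b` are homogeneous of the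
same degree. -/
theorem eulerPairing_pullbackΩ (m : Ω[ProjRatFun ℓ⁄ℂ]) : eulerPairing ℓ (pullbackΩ ℓ m) = 0 := by
  induction m using Ω_induction with
  | zero => simp
  | add x y hx hy => simp only [map_add, hx, hy, add_zero]
  | smul c x hx =>
    rw [map_smul, ← algebraMap_smul (RatFun ℓ) c, map_smul, hx, smul_zero]
  | D z =>
    obtain ⟨m, a, b, ha, hb, hb0, rfl⟩ := exists_eq_projFrac z
    rw [KaehlerDifferential.map_D, algebraMap_projFrac, Derivation.leibniz_div, map_smul, map_sub,
      map_smul, map_smul, eulerPairing_of_homogeneous ha, eulerPairing_of_homogeneous hb]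
    simp only [smul_eq_mul]
    ring

theorem eulerContract_ι_mul (m : Ω[RatFun ℓ⁄ℂ]) (ω : RatForms ℓ) :
    eulerContract ℓ (ExteriorAlgebra.ι _ m * ω) =
      eulerPairing ℓ m • ω - ExteriorAlgebra.ι _ m * eulerContract ℓ ω :=
  CliffordAlgebra.contractLeft_ι_mul _ _ _

theorem eulerContract_algebraMap (z : RatFun ℓ) : eulerContract ℓ (algebraMap _ _ z) = 0 :=
  CliffordAlgebra.contractLeft_algebraMap _ _ _

theorem forms_left_induction {A M : Type*} [CommRing A] [AddCommGroup M] [Module A M]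
    {P : ExteriorAlgebra A M → Prop}
    (algebraMap : ∀ r : A, P (algebraMap A _ r)) (add : ∀ x y, P x → P y → P (x + y))
    (ι_mul : ∀ x m, P x → P (ExteriorAlgebra.ι A m * x)) (ω) : P ω :=
  CliffordAlgebra.left_induction (0 : QuadraticForm A M) algebraMap add ι_mul ω

theorem eulerContract_projPullback (ω : ProjRatForms ℓ) :
    eulerContract ℓ (projPullback ℓ ω) = 0 := by
  induction ω using forms_left_induction with
  | algebraMap r => rw [projPullback_algebraMap, eulerContract_algebraMap]
  | add x y hx hy => rw [map_add, map_add, hx, hy, add_zero]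
  | ι_mul x m hx =>
    rw [map_mul, projPullback_ι, eulerContract_ι_mul, hx, eulerPairing_pullbackΩ, zero_smul,
      mul_zero, sub_zero]

/-- The rational `1`-form `dx_i / x_i`. -/
def dlogX (i : Fin ℓ) : Ω[RatFun ℓ⁄ℂ] :=
  (algebraMap (CoordRing ℓ) (RatFun ℓ) (MvPolynomial.X i))⁻¹ • dX i

/-- The projection `m ↦ m - ⟨χ, m⟩ dx_i / x_i` of the rational `1`-forms onto those that
`χ` annihilates. -/
def eulerProj (i : Fin ℓ) : Ω[RatFun ℓ⁄ℂ] →ₗ[RatFun ℓ] Ω[RatFun ℓ⁄ℂ] :=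
  LinearMap.id - (eulerPairing ℓ).smulRight (dlogX i)

theorem eulerProj_apply (i : Fin ℓ) (m : Ω[RatFun ℓ⁄ℂ]) :
    eulerProj i m = m - eulerPairing ℓ m • dlogX i := rfl

/-- In a product of factors `m - ⟨χ, m⟩ dx_i / x_i`, the terms with `dx_i / x_i` more than once
vanish; the terms with it exactly once assemble to the contraction. Hence the induced algebra map
fixes every form that `ι_χ` annihilates. -/
theorem map_eulerProj (i : Fin ℓ) (ω : RatForms ℓ) :
    ExteriorAlgebra.map (eulerProj i) ω =
      ω - ExteriorAlgebra.ι _ (dlogX i) * eulerContract ℓ ω := by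
  induction ω using forms_left_induction with
  | algebraMap r => rw [AlgHom.commutes, eulerContract_algebraMap, mul_zero, sub_zero]
  | add x y hx hy => rw [map_add, hx, hy, map_add, mul_add]; abel
  | ι_mul x m hx =>
    rw [map_mul, hx, ExteriorAlgebra.map_apply_ι, eulerContract_ι_mul, eulerProj_apply, map_sub,
      map_smul]
    set θ := ExteriorAlgebra.ι (RatFun ℓ) (dlogX i)
    set μ := ExteriorAlgebra.ι (RatFun ℓ) m
    have h1 : θ * μ = - (μ * θ) := eq_neg_of_add_eq_zero_left (ExteriorAlgebra.ι_add_mul_swap _ _)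
    have h2 : θ * θ = 0 := ExteriorAlgebra.ι_sq_zero _
    have h3 (η : RatForms ℓ) : θ * (θ * η) = 0 := by rw [← mul_assoc, h2, zero_mul]
    have h4 (η : RatForms ℓ) : θ * (μ * η) = - (μ * (θ * η)) := by
      rw [← mul_assoc, h1, neg_mul, mul_assoc]
    rw [sub_mul, mul_sub, mul_sub, mul_sub, smul_mul_assoc, smul_mul_assoc, h3, h4, mul_smul_comm]
    simp only [smul_zero, sub_zero, sub_neg_eq_add]
    abel

/-- This is the quotient rule `d(x_j / x_i) = x_i⁻¹ (dx_j - x_j dx_i / x_i)`, as `⟨χ, dx_j⟩ = x_j`.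
-/
theorem eulerProj_dX (i j : Fin ℓ) :
    (algebraMap (CoordRing ℓ) (RatFun ℓ) (MvPolynomial.X i))⁻¹ • eulerProj i (dX j) =
      pullbackΩ ℓ (dchart i j) := by
  have hX := algebraMap_X_ne_zero i
  rw [eulerProj_apply, eulerPairing_D_X, KaehlerDifferential.map_D, chartFun, algebraMap_projFrac,
    Derivation.leibniz_div, dlogX]
  simp only [smul_sub, smul_smul]
  congr 2
  · field_simp
  · field_simp

/-- The `p` factors `dx_j` take up degree `p`, so the coefficients have degree `n - p`, possibly
negative; division by `x_i ^ (n - p)` leaves degree zero. -/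
theorem exists_ratCoeff_of_homogeneousForms (i : Fin ℓ) {p : ℕ} {n : ℤ} {ω : RatForms ℓ}
    (hω : ω ∈ homogeneousForms ℓ p n) (r : Fin p → Fin ℓ) : ∃ z : ProjRatFun ℓ,
      ratCoeff r ω = algebraMap (CoordRing ℓ) (RatFun ℓ) (MvPolynomial.X i) ^ (n - p) *
        algebraMap _ (RatFun ℓ) z := by
  have hX := algebraMap_X_ne_zero i
  induction hω using AddSubgroup.closure_induction with
  | zero => exact ⟨0, by simp⟩
  | add x y _ _ hx hy =>
    obtain ⟨a, ha⟩ := hx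
    obtain ⟨b, hb⟩ := hy
    exact ⟨a + b, by rw [map_add, map_add, ha, hb, mul_add]⟩
  | neg x _ hx =>
    obtain ⟨a, ha⟩ := hx
    exact ⟨-a, by rw [map_neg, map_neg, ha, mul_neg]⟩
  | mem x hx =>
    obtain ⟨c, e, a, b, s, ha, hb, hb0, hn, rfl⟩ := hx
    -- The coefficients of a product of the `dx_j` are determinants of Kronecker deltas, hence
    -- constants.
    let z₀ : ℂ := Matrix.det (.of fun k l => if r l = s k then 1 else 0)
    have hz : ratCoeff r (ExteriorAlgebra.ιMulti (RatFun ℓ) p fun j => dX (s j)) =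
        algebraMap ℂ (RatFun ℓ) z₀ := by
      rw [coeff_ιMulti, RingHom.map_det]
      congr 1
      ext k l
      rw [Matrix.of_apply, fieldPairing_D, MvPolynomial.pderiv_X, RingHom.mapMatrix_apply,
        Matrix.map_apply, Matrix.of_apply, Pi.single_apply, apply_ite (algebraMap ℂ (RatFun ℓ)),
        apply_ite (algebraMap (CoordRing ℓ) (RatFun ℓ))]
      simp only [map_one, map_zero, @eq_comm _ (r l)]
    refine ⟨algebraMap ℂ _ z₀ * (MvPolynomial.aeval (chartFun i) a /
      MvPolynomial.aeval (chartFun i) b), ?_⟩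
    rw [map_smul]
    refine (congrArg _ hz).trans ?_
    rw [algebraMap_eq_pow_mul i ha, algebraMap_eq_pow_mul i hb, map_mul, map_div₀,
      ← IsScalarTower.algebraMap_apply, show n - p = (c : ℤ) - e by omega, zpow_sub₀ hX,
      zpow_natCast, zpow_natCast, smul_eq_mul]
    ring

theorem homogeneousForms_le_pForms {p : ℕ} {n : ℤ} {ω : RatForms ℓ}
    (hω : ω ∈ homogeneousForms ℓ p n) : ω ∈ pForms ℂ (RatFun ℓ) p := by
  induction hω using AddSubgroup.closure_induction with
  | zero => exact zero_mem _
  | add x y _ _ hx hy => exact add_mem hx hy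
  | neg x _ hx => exact neg_mem hx
  | mem x hx =>
    obtain ⟨c, e, a, b, s, ha, hb, hb0, hn, rfl⟩ := hx
    exact Submodule.smul_mem _ _ (Submodule.subset_span
      ⟨fun j => algebraMap _ _ (MvPolynomial.X (s j)), rfl⟩)

/-- A homogeneous form of degree `d` divided by a polynomial of degree `d` is the pullback of a
rational form on `ℙV`, if `ι_χ` annihilates it. -/
theorem exists_projPullback_eq (i : Fin ℓ) {p d : ℕ} {ω : RatForms ℓ}
    (hω : ω ∈ homogeneousForms ℓ p d) (hχ : eulerContract ℓ ω = 0) {t : CoordRing ℓ}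
    (ht : t ∈ grading ℓ d) (ht0 : t ≠ 0) : ∃ η ∈ pForms ℂ (ProjRatFun ℓ) p,
      projPullback ℓ η = (algebraMap (CoordRing ℓ) (RatFun ℓ) t)⁻¹ • ω := by
  have hX := algebraMap_X_ne_zero i
  have ht' := algebraMap_ne_zero ht0
  choose z hz using exists_ratCoeff_of_homogeneousForms i hω
  -- The factor `p!` comes from the coefficient expansion; the second factor is the inverse of `t /
  -- x_i ^ d`.
  let c : ProjRatFun ℓ := (p.factorial : ProjRatFun ℓ)⁻¹ * (MvPolynomial.aeval (chartFun i) t)⁻¹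
  refine ⟨c • ∑ r : Fin p → Fin ℓ,
      z r • ExteriorAlgebra.ιMulti (ProjRatFun ℓ) p fun k => dchart i (r k), ?_, ?_⟩
  · exact Submodule.smul_mem _ _ (sum_mem fun r _ => Submodule.smul_mem _ _
      (Submodule.subset_span ⟨fun k => chartFun i (r k), rfl⟩))
  -- Here `ι_χ ω = 0` is used. Applying the projection to the expansion of `ω` replaces every `dx_j`
  -- by `x_i π^* d(x_j / x_i)`; these `p` factors `x_i` turn the `x_i ^ (d - p)` of the coefficients
  -- into `x_i ^ d`.
  · have h1 : ExteriorAlgebra.map (eulerProj i) ω = ω := by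
      rw [map_eulerProj, hχ, mul_zero, sub_zero]
    have h2 := congrArg (ExteriorAlgebra.map (eulerProj i))
      (factorial_smul_ratForm (homogeneousForms_le_pForms hω))
    rw [map_smul, h1, map_sum] at h2
    have h3 : (p.factorial : RatFun ℓ) • ω =
        algebraMap (CoordRing ℓ) (RatFun ℓ) (MvPolynomial.X i) ^ d • ∑ r : Fin p → Fin ℓ,
          algebraMap _ (RatFun ℓ) (z r) • projPullback ℓ
            (ExteriorAlgebra.ιMulti (ProjRatFun ℓ) p fun k => dchart i (r k)) := by
      rw [h2, Finset.smul_sum]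
      refine Finset.sum_congr rfl fun r _ => ?_
      have h4 : (ExteriorAlgebra.ιMulti (RatFun ℓ) p fun k => pullbackΩ ℓ (dchart i (r k))) =
          (algebraMap (CoordRing ℓ) (RatFun ℓ) (MvPolynomial.X i))⁻¹ ^ p •
            ExteriorAlgebra.ιMulti (RatFun ℓ) p fun k => eulerProj i (dX (r k)) := by
        have h5 := (ExteriorAlgebra.ιMulti (RatFun ℓ) p).toMultilinearMap.map_smul_univ
          (fun _ => (algebraMap (CoordRing ℓ) (RatFun ℓ) (MvPolynomial.X i))⁻¹)
          (fun k => eulerProj i (dX (r k)))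
        simp only [eulerProj_dX, Finset.prod_const, Finset.card_univ, Fintype.card_fin] at h5
        exact h5
      rw [map_smul, ExteriorAlgebra.map_apply_ιMulti, projPullback_ιMulti, h4, hz, smul_smul,
        smul_smul]
      congr 1
      rw [zpow_sub₀ hX, zpow_natCast, zpow_natCast, inv_pow]
      ring
    rw [projPullback_smul, map_sum]
    simp only [projPullback_smul]
    have h6 : (algebraMap (CoordRing ℓ) (RatFun ℓ) t)⁻¹ • ω =
        ((p.factorial : RatFun ℓ)⁻¹ * (algebraMap (CoordRing ℓ) (RatFun ℓ) t)⁻¹) •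
          ((p.factorial : RatFun ℓ) • ω) := by
      have := factorial_ne_zero' (F := RatFun ℓ) p
      rw [smul_smul, mul_right_comm, inv_mul_cancel₀ this, one_mul]
    rw [h6, h3, smul_smul]
    congr 1
    rw [algebraMap_eq_pow_mul i ht]
    simp only [c, map_mul, map_inv₀, map_natCast]
    field_simp

end Descent

/-! ### Regularity at a point of `ℙV`, read off from homogeneous denominators -/

section LocalForms

variable {ℓ : ℕ}

/-- Comparing components of degree `n + e` gives `a b = a_n b`, and `b` cancels. -/
theorem mem_grading_of_mul_mem {n e : ℕ} {a b : CoordRing ℓ} (hb : b ∈ grading ℓ e) (hb0 : b ≠ 0)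
    (hab : a * b ∈ grading ℓ (n + e)) : a ∈ grading ℓ n := by
  have h := DirectSum.coe_decompose_mul_of_right_mem_of_le (grading ℓ) (a := a) hb
    (Nat.le_add_left e n)
  rw [DirectSum.decompose_of_mem_same _ hab, Nat.add_sub_cancel] at h
  rw [mul_right_cancel₀ hb0 h]
  exact SetLike.coe_mem _

theorem mem_grading_of_smul_eq {d : ℕ} {t a : CoordRing ℓ} (ht : t ∈ grading ℓ d)
    {z : ProjRatFun ℓ} (h : algebraMap _ (RatFun ℓ) t * algebraMap _ (RatFun ℓ) z =
      algebraMap _ (RatFun ℓ) a) : a ∈ grading ℓ d := by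
  obtain ⟨m, b, c, hb, hc, hc0, rfl⟩ := exists_eq_projFrac z
  refine mem_grading_of_mul_mem hc hc0 ?_
  have h2 : a * c = t * b := by
    apply IsFractionRing.injective (CoordRing ℓ) (RatFun ℓ)
    rw [map_mul, map_mul, ← h, algebraMap_projFrac, mul_assoc,
      div_mul_cancel₀ _ (algebraMap_ne_zero hc0)]
  rw [h2]
  exact SetLike.mul_mem_graded ht hb

/-- A relevant prime cannot contain all the variables. In particular a point of `ℙV` forces `ℓ > 0`,
so a chart is available. -/
theorem exists_X_notMem (x : ProjectiveSpectrum (grading ℓ)) :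
    ∃ i, (MvPolynomial.X i : CoordRing ℓ) ∉ x.asHomogeneousIdeal := by
  by_contra! h
  refine x.not_irrelevant_le fun a ha => ?_
  have h1 : Ideal.span (MvPolynomial.X '' Set.univ) ≤ x.asHomogeneousIdeal.toIdeal :=
    Ideal.span_le.2 (by rintro _ ⟨i, -, rfl⟩; exact h i)
  refine h1 (MvPolynomial.mem_ideal_span_X_image.2 fun s hs => ?_)
  by_contra! h2
  -- Only the constant monomial involves no variable, and the constant term of an element of the
  -- irrelevant ideal is zero.
  have hs0 : s = 0 := Finsupp.ext fun i => h2 i trivial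
  have h3 : MvPolynomial.homogeneousComponent 0 a = 0 := by
    have h4 := (HomogeneousIdeal.mem_irrelevant_iff _ _).1 ha
    exact (MvPolynomial.decomposition.decompose'_apply a 0).symm.trans h4
  have h5 := MvPolynomial.coeff_homogeneousComponent 0 a s
  rw [h3, hs0] at h5
  rw [hs0, MvPolynomial.mem_support_iff] at hs
  exact hs (by simpa using h5.symm)

theorem mul_notMem (x : ProjectiveSpectrum (grading ℓ)) {a b : CoordRing ℓ}
    (ha : a ∉ x.asHomogeneousIdeal) (hb : b ∉ x.asHomogeneousIdeal) :
    a * b ∉ x.asHomogeneousIdeal :=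
  fun h => (x.isPrime.mem_or_mem h).elim ha hb

theorem one_notMem (x : ProjectiveSpectrum (grading ℓ)) : (1 : CoordRing ℓ) ∉ x.asHomogeneousIdeal :=
  (Ideal.ne_top_iff_one _).1 x.isPrime.ne_top

theorem pow_notMem (x : ProjectiveSpectrum (grading ℓ)) {a : CoordRing ℓ}
    (ha : a ∉ x.asHomogeneousIdeal) (n : ℕ) : a ^ n ∉ x.asHomogeneousIdeal :=
  fun h => ha (x.isPrime.mem_of_pow_mem n h)

theorem ne_zero_of_notMem (x : ProjectiveSpectrum (grading ℓ)) {a : CoordRing ℓ}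
    (ha : a ∉ x.asHomogeneousIdeal) : a ≠ 0 :=
  fun h => ha (h ▸ zero_mem _)

/-- The fraction `a / t` in the local ring at `x`. -/
def localFrac (x : ProjectiveSpectrum (grading ℓ)) {d : ℕ} {a t : CoordRing ℓ}
    (ha : a ∈ grading ℓ d) (ht : t ∈ grading ℓ d) (htx : t ∉ x.asHomogeneousIdeal) :
    LocalRingAt x :=
  .mk ⟨d, ⟨a, ha⟩, ⟨t, ht⟩, htx⟩

theorem algebraMap_localFrac (x : ProjectiveSpectrum (grading ℓ)) {d : ℕ} {a t : CoordRing ℓ}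
    (ha : a ∈ grading ℓ d) (ht : t ∈ grading ℓ d) (htx : t ∉ x.asHomogeneousIdeal) :
    algebraMap _ (ProjRatFun ℓ) (localFrac x ha ht htx) =
      projFrac a t ha ht (ne_zero_of_notMem x htx) :=
  algebraMap_proj_injective (algebraMap_mk x d ⟨a, ha⟩ ⟨t, ht⟩ htx)

/-- The polynomial `a` need not be assumed homogeneous: since `z` has degree zero, `a = t z`
inherits the degree of `t`, and `z = a / t`. -/
theorem exists_localRing_eq (x : ProjectiveSpectrum (grading ℓ)) {d : ℕ} {t a : CoordRing ℓ}
    (ht : t ∈ grading ℓ d) (htx : t ∉ x.asHomogeneousIdeal) {z : ProjRatFun ℓ}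
    (h : algebraMap _ (RatFun ℓ) t * algebraMap _ (RatFun ℓ) z = algebraMap _ (RatFun ℓ) a) :
    ∃ y : LocalRingAt x, algebraMap _ (ProjRatFun ℓ) y = z := by
  refine ⟨localFrac x (mem_grading_of_smul_eq ht h) ht htx, algebraMap_proj_injective ?_⟩
  rw [algebraMap_localFrac, algebraMap_projFrac]
  exact (eq_div_of_mul_eq (algebraMap_ne_zero (ne_zero_of_notMem x htx))
    (by rw [mul_comm]; exact h)).symm

theorem ιMulti_dchart_mem_projForms (x : ProjectiveSpectrum (grading ℓ)) {i : Fin ℓ}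
    (hi : MvPolynomial.X i ∉ x.asHomogeneousIdeal) {p : ℕ} (r : Fin p → Fin ℓ) :
    (ExteriorAlgebra.ιMulti (ProjRatFun ℓ) p fun k => dchart i (r k)) ∈ projForms x p := by
  have h (k : Fin p) : algebraMap _ (ProjRatFun ℓ)
      (localFrac x (X_mem_grading (r k)) (X_mem_grading i) hi) = chartFun i (r k) :=
    algebraMap_localFrac x (X_mem_grading (r k)) (X_mem_grading i) hi
  simp only [dchart, ← h]
  exact Submodule.subset_span ⟨_, rfl⟩

theorem exists_localRing_eq_projCoeff (x : ProjectiveSpectrum (grading ℓ)) (i : Fin ℓ) {p d : ℕ}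
    {ω : ProjRatForms ℓ} (hω : ω ∈ pForms ℂ (ProjRatFun ℓ) p) {t : CoordRing ℓ}
    (ht : t ∈ grading ℓ d) (htx : t ∉ x.asHomogeneousIdeal)
    (h : t • projPullback ℓ ω ∈ polyForms ℓ p) (r : Fin p → Fin ℓ) :
    ∃ y : LocalRingAt x,
      algebraMap _ (ProjRatFun ℓ) y = (p.factorial : ProjRatFun ℓ)⁻¹ * projCoeff i r ω := by
  obtain ⟨a, ha⟩ := ratCoeff_mem_range h r
  rw [← algebraMap_smul_forms t, map_smul, smul_eq_mul] at ha
  refine exists_localRing_eq x ht htx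
    (a := algebraMap ℂ _ (p.factorial : ℂ)⁻¹ * (MvPolynomial.X i ^ p * a)) ?_
  rw [map_mul, algebraMap_projCoeff i r hω, map_mul, map_mul, ← ha,
    ← IsScalarTower.algebraMap_apply, map_inv₀, map_inv₀, map_natCast, map_natCast, map_pow]
  ring

/-- A rational form on `ℙV` is regular at `x` if its pullback has a homogeneous denominator that
does not vanish at `x`. -/
theorem mem_projForms_of_smul_mem (x : ProjectiveSpectrum (grading ℓ)) {p d : ℕ}
    {ω : ProjRatForms ℓ} (hω : ω ∈ pForms ℂ (ProjRatFun ℓ) p) {t : CoordRing ℓ}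
    (ht : t ∈ grading ℓ d) (htx : t ∉ x.asHomogeneousIdeal)
    (h : t • projPullback ℓ ω ∈ polyForms ℓ p) : ω ∈ projForms x p := by
  -- Here the chart must contain `x`, for the `d(x_j / x_i)` to be regular at `x`.
  obtain ⟨i, hi⟩ := exists_X_notMem x
  have h1 : ω = ∑ r : Fin p → Fin ℓ, ((p.factorial : ProjRatFun ℓ)⁻¹ * projCoeff i r ω) •
      ExteriorAlgebra.ιMulti (ProjRatFun ℓ) p fun k => dchart i (r k) := by
    simp only [mul_smul]
    rw [← Finset.smul_sum, ← factorial_smul_projForm i hω, smul_smul,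
      inv_mul_cancel₀ (factorial_ne_zero' p), one_smul]
  rw [h1]
  refine sum_mem fun r _ => ?_
  obtain ⟨y, hy⟩ := exists_localRing_eq_projCoeff x i hω ht htx h r
  rw [← hy, algebraMap_smul_forms]
  exact Submodule.smul_mem _ _ (ιMulti_dchart_mem_projForms x hi r)

/-- As `s² d(a / s) = s da - a ds`, each factor is cleared by the square of its denominator. -/
theorem exists_smul_ιMulti_mem (x : ProjectiveSpectrum (grading ℓ)) {p : ℕ}
    (b : Fin p → LocalRingAt x) : ∃ (d : ℕ) (t : CoordRing ℓ), t ∈ grading ℓ d ∧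
      t ∉ x.asHomogeneousIdeal ∧ t • projPullback ℓ (ExteriorAlgebra.ιMulti (ProjRatFun ℓ) p
        fun i => KaehlerDifferential.D ℂ (ProjRatFun ℓ) (algebraMap _ _ (b i))) ∈
          polyForms ℓ p := by
  induction p with
  | zero =>
    refine ⟨0, 1, SetLike.one_mem_graded _, one_notMem x, ?_⟩
    rw [one_smul, projPullback_ιMulti, ExteriorAlgebra.ιMulti_zero_apply]
    exact Submodule.subset_span ⟨Fin.elim0, ExteriorAlgebra.ιMulti_zero_apply _⟩
  | succ p ih =>
    obtain ⟨d, t, ht, htx, h⟩ := ih fun i => b i.succ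
    obtain ⟨⟨e, a, s, hs⟩, hb⟩ := HomogeneousLocalization.mk_surjective (b 0)
    refine ⟨_, (s * s) * t, SetLike.mul_mem_graded (SetLike.mul_mem_graded s.2 s.2) ht,
      mul_notMem x (mul_notMem x hs hs) htx, ?_⟩
    have h1 := ExteriorAlgebra.ιMulti_succ_apply (R := ProjRatFun ℓ) fun i =>
      KaehlerDifferential.D ℂ (ProjRatFun ℓ) (algebraMap _ _ (b i))
    rw [h1, map_mul, mul_smul, ← mul_smul_comm, ← smul_mul_assoc]
    have h2 : ((s : CoordRing ℓ) * s) • projPullback ℓ (dd ℂ _ (algebraMap _ _ (b 0))) =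
        (s : CoordRing ℓ) • dd ℂ (RatFun ℓ) (algebraMap _ _ (a : CoordRing ℓ)) -
          (a : CoordRing ℓ) • dd ℂ (RatFun ℓ) (algebraMap _ _ (s : CoordRing ℓ)) := by
      have hs0 := algebraMap_ne_zero (ne_zero_of_notMem x hs)
      rw [projPullback_dd, ← hb, algebraMap_mk, dd, Derivation.leibniz_div, map_smul, map_sub,
        map_smul, map_smul, ← algebraMap_smul_forms, smul_smul, algebraMap_smul_forms,
        algebraMap_smul_forms, map_mul, inv_pow, ← pow_two,
        mul_inv_cancel₀ (pow_ne_zero 2 hs0), one_smul]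
    have h3 := congrArg (· * t • projPullback ℓ (ExteriorAlgebra.ιMulti (ProjRatFun ℓ) p
        fun i => KaehlerDifferential.D ℂ (ProjRatFun ℓ) (algebraMap _ _ (b i.succ)))) h2
    refine (congrArg (· ∈ polyForms ℓ (p + 1)) h3).mpr ?_
    rw [sub_mul, smul_mul_assoc, smul_mul_assoc]
    exact sub_mem (Submodule.smul_mem _ _ (dd_mul_mem_regularForms _ h))
      (Submodule.smul_mem _ _ (dd_mul_mem_regularForms _ h))

theorem exists_smul_mem_of_mem_projForms (x : ProjectiveSpectrum (grading ℓ)) {p : ℕ}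
    {ω : ProjRatForms ℓ} (hω : ω ∈ projForms x p) : ∃ (d : ℕ) (t : CoordRing ℓ),
      t ∈ grading ℓ d ∧ t ∉ x.asHomogeneousIdeal ∧ t • projPullback ℓ ω ∈ polyForms ℓ p := by
  induction hω using Submodule.span_induction with
  | zero => exact ⟨0, 1, SetLike.one_mem_graded _, one_notMem x, by simp⟩
  | add y z _ _ hy hz =>
    obtain ⟨d, t, ht, htx, h⟩ := hy
    obtain ⟨e, s, hs, hsx, h'⟩ := hz
    refine ⟨_, t * s, SetLike.mul_mem_graded ht hs, mul_notMem x htx hsx, ?_⟩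
    rw [map_add, smul_add]
    refine add_mem ?_ ?_
    · rw [mul_comm, mul_smul]; exact Submodule.smul_mem _ _ h
    · rw [mul_smul]; exact Submodule.smul_mem _ _ h'
  | smul c y _ hy =>
    obtain ⟨d, t, ht, htx, h⟩ := hy
    obtain ⟨⟨e, a, s, hs⟩, rfl⟩ := HomogeneousLocalization.mk_surjective c
    refine ⟨_, s * t, SetLike.mul_mem_graded s.2 ht, mul_notMem x hs htx, ?_⟩
    have h1 : ((s : CoordRing ℓ) * t) • projPullback ℓ
        ((HomogeneousLocalization.mk ⟨e, a, s, hs⟩ : LocalRingAt x) • y) =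
          (a : CoordRing ℓ) • t • projPullback ℓ y := by
      have hs0 := algebraMap_ne_zero (ne_zero_of_notMem x hs)
      rw [← algebraMap_smul_forms (K := ProjRatFun ℓ), projPullback_smul, algebraMap_mk,
        ← algebraMap_smul_forms, ← algebraMap_smul_forms (a : CoordRing ℓ),
        ← algebraMap_smul_forms t, smul_smul, smul_smul, map_mul]
      congr 1
      field_simp
    rw [h1]
    exact Submodule.smul_mem _ _ h
  | mem y hy =>
    obtain ⟨b, rfl⟩ := hy
    exact exists_smul_ιMulti_mem x b

end LocalForms

/-! ### Logarithmic forms on `V`: simple poles of `ω` and `dω` -/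

section Arrangements

variable {ℓ : ℕ}

theorem eval_linPoly (α : Module.Dual ℂ (Fin ℓ → ℂ)) (v : Fin ℓ → ℂ) :
    MvPolynomial.eval v (linPoly α) = α v := by
  rw [LinearMap.pi_apply_eq_sum_univ α v]
  have h (i : Fin ℓ) : (Pi.single i 1 : Fin ℓ → ℂ) = fun j => if i = j then 1 else 0 := by
    ext j
    simp only [Pi.single_apply, @eq_comm _ j]
  simp [linPoly, mul_comm, h]

theorem linPoly_ne_zero {α : Module.Dual ℂ (Fin ℓ → ℂ)} (hα : α ≠ 0) : linPoly α ≠ 0 := by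
  intro h
  refine hα (LinearMap.ext fun v => ?_)
  rw [← eval_linPoly, h, map_zero, LinearMap.zero_apply]

theorem prime_linPoly {α : Module.Dual ℂ (Fin ℓ → ℂ)} (hα : α ≠ 0) : Prime (linPoly α) := by
  have h0 := linPoly_ne_zero hα
  rw [← UniqueFactorizationMonoid.irreducible_iff_prime]
  refine MvPolynomial.irreducible_of_totalDegree_eq_one
    (MvPolynomial.IsHomogeneous.totalDegree (linPoly_mem α) h0) fun c hc => ?_
  refine IsUnit.mk0 c fun hc0 => h0 ?_
  ext s
  have := hc s
  rwa [hc0, zero_dvd_iff] at this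

theorem ker_le_of_linPoly_dvd {α β : Module.Dual ℂ (Fin ℓ → ℂ)} (h : linPoly α ∣ linPoly β) :
    LinearMap.ker α ≤ LinearMap.ker β := by
  obtain ⟨q, hq⟩ := h
  intro v hv
  rw [LinearMap.mem_ker] at hv ⊢
  rw [← eval_linPoly, hq, map_mul, eval_linPoly, hv, zero_mul]

variable (𝒜 : Arrangement ℓ)

theorem Arrangement.poly_ne_zero (H : 𝒜.hyperplanes) : 𝒜.poly H ≠ 0 :=
  linPoly_ne_zero (𝒜.form_ne_zero H)

theorem Arrangement.defPoly_ne_zero : 𝒜.defPoly ≠ 0 :=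
  Finset.prod_ne_zero_iff.2 fun H _ => 𝒜.poly_ne_zero H

/-- Primes that divide each other are associated, so the two linear forms have the same kernel. -/
theorem Arrangement.eq_of_poly_dvd {H H' : 𝒜.hyperplanes} (h : 𝒜.poly H ∣ 𝒜.poly H') : H = H' := by
  have h1 := (prime_linPoly (𝒜.form_ne_zero H)).dvd_prime_iff_associated
    (prime_linPoly (𝒜.form_ne_zero H'))
  have h2 := (h1.1 h).symm.dvd
  refine Subtype.ext ?_
  rw [← 𝒜.ker_form H, ← 𝒜.ker_form H']
  exact le_antisymm (ker_le_of_linPoly_dvd h) (ker_le_of_linPoly_dvd h2)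

theorem dd_prod {k F : Type*} [CommRing k] [Field F] [Algebra k F] {ι : Type*} (s : Finset ι)
    (a : ι → F) (ha : ∀ i, a i ≠ 0) :
    dd k F (∏ i ∈ s, a i) = (∏ i ∈ s, a i) • ∑ i ∈ s, (a i)⁻¹ • dd k F (a i) := by
  classical
  induction s using Finset.induction_on with
  | empty =>
    rw [Finset.prod_empty, Finset.sum_empty, smul_zero, ← map_one (algebraMap k F),
      dd_algebraMap]
  | insert i s hi ih =>
    rw [Finset.prod_insert hi, Finset.sum_insert hi, dd_mul, ih, smul_add, smul_smul, smul_smul,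
      add_comm]
    congr 2
    rw [mul_comm, inv_mul_cancel_left₀ (ha i)]

theorem Arrangement.dd_defPoly : dd ℂ (RatFun ℓ) (algebraMap _ _ 𝒜.defPoly) =
    𝒜.defPoly • ∑ H, 𝒜.dlog H := by
  rw [← algebraMap_smul_forms, Arrangement.defPoly, map_prod,
    dd_prod _ _ fun H => algebraMap_ne_zero (𝒜.poly_ne_zero H)]
  rfl

theorem Arrangement.mem_simplePoles {p : ℕ} {ω : RatForms ℓ} :
    ω ∈ 𝒜.simplePoles p ↔ 𝒜.defPoly • ω ∈ polyForms ℓ p := Iff.rfl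

theorem Arrangement.mem_logForms {p : ℕ} {ω : RatForms ℓ} : ω ∈ 𝒜.logForms p ↔
    𝒜.defPoly • ω ∈ polyForms ℓ p ∧
      ∀ H, 𝒜.defPoly • (𝒜.dlog H * ω) ∈ polyForms ℓ (p + 1) := by
  rw [Arrangement.logForms, Submodule.mem_inf, Submodule.mem_iInf]
  rfl

/-- The Leibniz rule for `f ω`. -/
theorem Arrangement.extDiff_defPoly_smul (ω : RatForms ℓ) :
    extDiff ℂ _ (𝒜.defPoly • ω) =
      ∑ H, 𝒜.defPoly • (𝒜.dlog H * ω) + 𝒜.defPoly • extDiff ℂ _ ω := by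
  rw [← algebraMap_smul_forms 𝒜.defPoly ω, extDiff_smul, 𝒜.dd_defPoly, algebraMap_smul_forms,
    smul_mul_assoc, Finset.sum_mul, Finset.smul_sum]

/-- In the Leibniz rule for `f ω`, all terms but `f dω` are polynomial. -/
theorem Arrangement.extDiff_mem_of_mem_logForms {p : ℕ} {ω : RatForms ℓ}
    (hω : ω ∈ 𝒜.logForms p) : extDiff ℂ _ ω ∈ 𝒜.simplePoles (p + 1) := by
  rw [𝒜.mem_logForms] at hω
  have h := extDiff_mem_regularForms hω.1
  rw [𝒜.extDiff_defPoly_smul] at h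
  exact (Submodule.add_mem_iff_right _ (sum_mem fun H _ => hω.2 H)).1 h

/-- Uniqueness of partial fractions: after multiplication by `f`, every term except that of `H`
contains `α_H`. So `α_H` divides `c_H ∏_{H' ≠ H} α_{H'}`, and as a prime dividing no other `α_{H'}`
it divides `c_H`. -/
theorem Arrangement.poly_dvd_of_sum {c : 𝒜.hyperplanes → CoordRing ℓ} {g : CoordRing ℓ}
    (h : ∑ H, algebraMap _ (RatFun ℓ) (c H) / algebraMap _ (RatFun ℓ) (𝒜.poly H) =
      algebraMap _ (RatFun ℓ) g) (H : 𝒜.hyperplanes) : 𝒜.poly H ∣ c H := by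
  classical
  have hf (H : 𝒜.hyperplanes) :
      𝒜.poly H * ∏ H' ∈ Finset.univ.erase H, 𝒜.poly H' = 𝒜.defPoly :=
    Finset.mul_prod_erase _ _ (Finset.mem_univ H)
  have h1 : ∑ H, c H * ∏ H' ∈ Finset.univ.erase H, 𝒜.poly H' = g * 𝒜.defPoly := by
    apply IsFractionRing.injective (CoordRing ℓ) (RatFun ℓ)
    rw [map_mul, ← h, map_sum, Finset.sum_mul]
    refine Finset.sum_congr rfl fun H _ => ?_
    have := algebraMap_ne_zero (𝒜.poly_ne_zero H)
    rw [map_mul, ← hf H, map_mul]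
    field_simp
  have h2 : 𝒜.poly H ∣ c H * ∏ H' ∈ Finset.univ.erase H, 𝒜.poly H' := by
    rw [← Finset.add_sum_erase _ _ (Finset.mem_univ H)] at h1
    rw [eq_sub_of_add_eq h1, ← hf H]
    refine dvd_sub (Dvd.intro _ rfl |>.mul_left g) (Finset.dvd_sum fun H' hH' => ?_)
    exact (Finset.dvd_prod_of_mem _ (Finset.mem_erase.2
      ⟨(Finset.ne_of_mem_erase hH').symm, Finset.mem_univ H⟩)).mul_left _
  refine ((prime_linPoly (𝒜.form_ne_zero H)).dvd_or_dvd h2).resolve_right fun h3 => ?_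
  obtain ⟨H', hH', h4⟩ := (prime_linPoly (𝒜.form_ne_zero H)).exists_mem_finset_dvd h3
  exact Finset.ne_of_mem_erase hH' (𝒜.eq_of_poly_dvd h4).symm

/-- Leibniz gives only that the sum of the `f dα_H / α_H ∧ ω` is polynomial. Each coefficient of the
summand of `H` is a polynomial over `α_H`, so `poly_dvd_of_sum` separates the summands. -/
theorem Arrangement.mem_logForms_of_extDiff_mem {p : ℕ} {ω : RatForms ℓ}
    (hω : ω ∈ 𝒜.simplePoles p) (hd : extDiff ℂ _ ω ∈ 𝒜.simplePoles (p + 1)) :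
    ω ∈ 𝒜.logForms p := by
  rw [𝒜.mem_simplePoles] at hω hd
  refine 𝒜.mem_logForms.2 ⟨hω, ?_⟩
  have h1 := extDiff_mem_regularForms hω
  rw [𝒜.extDiff_defPoly_smul] at h1
  have h2 := (Submodule.add_mem_iff_left _ hd).1 h1
  have h3 (H) : 𝒜.defPoly • (𝒜.dlog H * ω) =
      (algebraMap _ (RatFun ℓ) (𝒜.poly H))⁻¹ •
        (dd ℂ (RatFun ℓ) (algebraMap _ _ (𝒜.poly H)) * 𝒜.defPoly • ω) := by
    rw [← mul_smul_comm, Arrangement.dlog, smul_mul_assoc]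
  have h4 (H) := dd_mul_mem_regularForms (𝒜.poly H) hω
  have h5 (H) (r : Fin (p + 1) → Fin ℓ) := ratCoeff_mem_range (h4 H) r
  choose c hc using h5
  intro H
  refine mem_polyForms_of_ratCoeff ?_ fun r => ?_
  · rw [h3]
    exact Submodule.smul_mem _ _ (regularForms_le_pForms (h4 H))
  · obtain ⟨g, hg⟩ := ratCoeff_mem_range h2 r
    have h6 (H) : ratCoeff r (𝒜.defPoly • (𝒜.dlog H * ω)) =
        algebraMap _ (RatFun ℓ) (c H r) / algebraMap _ (RatFun ℓ) (𝒜.poly H) := by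
      rw [h3, map_smul, hc, smul_eq_mul, mul_comm, div_eq_mul_inv]
    rw [map_sum, Finset.sum_congr rfl fun H _ => h6 H] at hg
    obtain ⟨q, hq⟩ := 𝒜.poly_dvd_of_sum hg H
    refine ⟨q, ?_⟩
    rw [h6, hq, map_mul, mul_div_cancel_left₀ _ (algebraMap_ne_zero (𝒜.poly_ne_zero H))]

end Arrangements

/-! ### Comparison of the two sheaves -/

section Comparison

variable {ℓ : ℕ} (𝒜 : Arrangement ℓ)

theorem Arrangement.mem_projSimplePoles {x : ProjectiveSpectrum (grading ℓ)} {p : ℕ}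
    {ω : ProjRatForms ℓ} : ω ∈ 𝒜.projSimplePoles x p ↔
      ∀ (s : grading ℓ 𝒜.card) (hs : (s : CoordRing ℓ) ∉ x.asHomogeneousIdeal),
        𝒜.localEq x s hs • ω ∈ projForms x p := by
  simp only [Arrangement.projSimplePoles, Submodule.mem_iInf, Submodule.mem_comap,
      LinearMap.lsmul_apply]

theorem Arrangement.smul_projPullback_localEq (x : ProjectiveSpectrum (grading ℓ))
    (s : grading ℓ 𝒜.card) (hs : (s : CoordRing ℓ) ∉ x.asHomogeneousIdeal) (ω : ProjRatForms ℓ) :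
    (s : CoordRing ℓ) • projPullback ℓ (𝒜.localEq x s hs • ω) =
      𝒜.defPoly • projPullback ℓ ω := by
  have h : algebraMap _ (RatFun ℓ) (algebraMap _ (ProjRatFun ℓ) (𝒜.localEq x s hs)) =
      algebraMap _ (RatFun ℓ) 𝒜.defPoly / algebraMap _ (RatFun ℓ) (s : CoordRing ℓ) :=
    algebraMap_mk x _ _ _ hs
  rw [← algebraMap_smul_forms (K := ProjRatFun ℓ), projPullback_smul, h,
    ← algebraMap_smul_forms, smul_smul, ← algebraMap_smul_forms 𝒜.defPoly,
    mul_div_cancel₀ _ (algebraMap_ne_zero (ne_zero_of_notMem x hs))]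

theorem Arrangement.mem_projSimplePoles_of_smul_mem {x : ProjectiveSpectrum (grading ℓ)} {p d : ℕ}
    {ω : ProjRatForms ℓ} (hω : ω ∈ pForms ℂ (ProjRatFun ℓ) p) {t : CoordRing ℓ}
    (ht : t ∈ grading ℓ d) (htx : t ∉ x.asHomogeneousIdeal)
    (h : t • projPullback ℓ ω ∈ 𝒜.simplePoles p) : ω ∈ 𝒜.projSimplePoles x p := by
  rw [𝒜.mem_projSimplePoles]
  intro s hs
  have h1 : 𝒜.localEq x s hs • ω ∈ pForms ℂ (ProjRatFun ℓ) p := by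
    rw [← algebraMap_smul_forms (K := ProjRatFun ℓ)]
    exact Submodule.smul_mem _ _ hω
  refine mem_projForms_of_smul_mem x h1 (SetLike.mul_mem_graded ht s.2) (mul_notMem x htx hs) ?_
  rw [mul_smul, 𝒜.smul_projPullback_localEq, smul_comm]
  exact h

theorem Arrangement.mem_pForms_of_mem_projSimplePoles {x : ProjectiveSpectrum (grading ℓ)}
    {p : ℕ} {ω : ProjRatForms ℓ} (hω : ω ∈ 𝒜.projSimplePoles x p) :
    ω ∈ pForms ℂ (ProjRatFun ℓ) p ∧ ∃ (d : ℕ) (t : CoordRing ℓ), t ∈ grading ℓ d ∧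
      t ∉ x.asHomogeneousIdeal ∧ t • projPullback ℓ ω ∈ 𝒜.simplePoles p := by
  obtain ⟨i, hi⟩ := exists_X_notMem x
  -- Any form of degree `deg f` off `x` gives a local equation of `D`; a power of a variable off `x`
  -- is one.
  let s : grading ℓ 𝒜.card := ⟨MvPolynomial.X i ^ 𝒜.card, by
    simpa using SetLike.pow_mem_graded 𝒜.card (X_mem_grading i)⟩
  have hs : (s : CoordRing ℓ) ∉ x.asHomogeneousIdeal := pow_notMem x hi _
  have h1 := 𝒜.mem_projSimplePoles.1 hω s hs
  constructor
  · have h2 := regularForms_le_pForms h1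
    have h3 : algebraMap _ (ProjRatFun ℓ) (𝒜.localEq x s hs) ≠ 0 := by
      intro h0
      have h := algebraMap_mk x _ ⟨𝒜.defPoly, 𝒜.defPoly_mem⟩ s hs
      refine div_ne_zero (algebraMap_ne_zero 𝒜.defPoly_ne_zero)
        (algebraMap_ne_zero (ne_zero_of_notMem x hs)) (h.symm.trans ?_)
      exact (congrArg _ h0).trans (map_zero _)
    rw [← algebraMap_smul_forms (K := ProjRatFun ℓ)] at h2
    exact (Submodule.smul_mem_iff _ h3).1 h2
  · obtain ⟨d, t, ht, htx, h⟩ := exists_smul_mem_of_mem_projForms x h1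
    refine ⟨d, t, ht, htx, ?_⟩
    rw [𝒜.mem_simplePoles, smul_comm, ← 𝒜.smul_projPullback_localEq x s hs, smul_comm]
    exact Submodule.smul_mem _ _ h

theorem Arrangement.dd_mul_mem_simplePoles {p : ℕ} {ω : RatForms ℓ} (hω : ω ∈ 𝒜.simplePoles p)
    (t : CoordRing ℓ) : dd ℂ (RatFun ℓ) (algebraMap _ _ t) * ω ∈ 𝒜.simplePoles (p + 1) := by
  rw [𝒜.mem_simplePoles, ← mul_smul_comm]
  exact dd_mul_mem_regularForms t hω

theorem extDiff_polynomial_smul (t : CoordRing ℓ) (ω : RatForms ℓ) : extDiff ℂ _ (t • ω) =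
    dd ℂ (RatFun ℓ) (algebraMap _ _ t) * ω + t • extDiff ℂ _ ω := by
  rw [← algebraMap_smul_forms t ω, extDiff_smul, algebraMap_smul_forms]

theorem Arrangement.mem_projLogForms_of_smul_mem {x : ProjectiveSpectrum (grading ℓ)} {p d : ℕ}
    {ω : ProjRatForms ℓ} (hω : ω ∈ pForms ℂ (ProjRatFun ℓ) p) {t : CoordRing ℓ}
    (ht : t ∈ grading ℓ d) (htx : t ∉ x.asHomogeneousIdeal)
    (h : t • projPullback ℓ ω ∈ 𝒜.logForms p) : ω ∈ 𝒜.projLogForms x p := by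
  have h0 : t • projPullback ℓ ω ∈ 𝒜.simplePoles p := h.1
  refine ⟨𝒜.mem_projSimplePoles_of_smul_mem hω ht htx h0,
    𝒜.mem_projSimplePoles_of_smul_mem (extDiff_mem_regularForms hω)
      (SetLike.mul_mem_graded ht ht) (mul_notMem x htx htx) ?_⟩
  -- With `η` the pullback, `t² dη = t d(t η) - dt ∧ t η`: the second factor `t` makes the error
  -- term a multiple of `t η`.
  have h1 := Submodule.smul_mem _ t (𝒜.extDiff_mem_of_mem_logForms h)
  rw [extDiff_polynomial_smul, smul_add, ← mul_smul_comm, smul_smul, ← projPullback_extDiff] at h1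
  exact (Submodule.add_mem_iff_right _ (𝒜.dd_mul_mem_simplePoles h0 t)).1 h1

theorem Arrangement.exists_smul_mem_logForms {x : ProjectiveSpectrum (grading ℓ)} {p : ℕ}
    {ω : ProjRatForms ℓ} (hω : ω ∈ 𝒜.projLogForms x p) : ω ∈ pForms ℂ (ProjRatFun ℓ) p ∧
      ∃ (d : ℕ) (t : CoordRing ℓ), t ∈ grading ℓ d ∧ t ∉ x.asHomogeneousIdeal ∧
        t • projPullback ℓ ω ∈ 𝒜.logForms p := by
  obtain ⟨hp, d, t, ht, htx, h⟩ := 𝒜.mem_pForms_of_mem_projSimplePoles hω.1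
  obtain ⟨-, e, s, hs, hsx, h'⟩ := 𝒜.mem_pForms_of_mem_projSimplePoles hω.2
  have h1 : (t * s) • projPullback ℓ ω ∈ 𝒜.simplePoles p := by
    rw [mul_comm, mul_smul]
    exact Submodule.smul_mem _ _ h
  have h2 : (t * s) • extDiff ℂ _ (projPullback ℓ ω) ∈ 𝒜.simplePoles (p + 1) := by
    rw [mul_smul, ← projPullback_extDiff]
    exact Submodule.smul_mem _ _ h'
  have hts := SetLike.mul_mem_graded ht hs
  have htsx := mul_notMem x htx hsx
  -- The product `t s` clears both `ω` and `dω`, up to simple poles. Its square is needed because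
  -- `d((ts)² ω)` contains `d(ts) ∧ ω`, which then still carries a factor `t s`.
  refine ⟨hp, _, _, SetLike.mul_mem_graded hts hts, mul_notMem x htsx htsx,
    𝒜.mem_logForms_of_extDiff_mem ?_ ?_⟩
  · rw [mul_smul]
    exact Submodule.smul_mem _ _ h1
  · have h3 := 𝒜.dd_mul_mem_simplePoles h1 (t * s)
    rw [mul_smul, extDiff_polynomial_smul, extDiff_polynomial_smul, smul_add]
    refine add_mem h3 (add_mem ?_ (Submodule.smul_mem _ _ h2))
    rwa [← mul_smul_comm]

/-- The coefficients are functions of degree zero divided by `x_i ^ p`, which offsets the degree `p`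
of the `dx_j`. -/
theorem projPullback_mem_homogeneousForms (i : Fin ℓ) {p : ℕ} {ω : ProjRatForms ℓ}
    (hω : ω ∈ pForms ℂ (ProjRatFun ℓ) p) : projPullback ℓ ω ∈ homogeneousForms ℓ p 0 := by
  have hX := algebraMap_X_ne_zero i
  have hp := factorial_ne_zero' (F := RatFun ℓ) p
  have h1 := factorial_smul_ratForm (projPullback_mem_pForms hω)
  have h2 : projPullback ℓ ω = ∑ r : Fin p → Fin ℓ,
      ((p.factorial : RatFun ℓ)⁻¹ * ratCoeff r (projPullback ℓ ω)) •
        ExteriorAlgebra.ιMulti (RatFun ℓ) p fun i => dX (r i) := by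
    simp only [mul_smul]
    rw [← Finset.smul_sum, ← h1, smul_smul, inv_mul_cancel₀ hp, one_smul]
  rw [h2]
  refine sum_mem fun r _ => ?_
  have h3 := algebraMap_projCoeff i r hω
  obtain ⟨m, a, b, ha, hb, hb0, hz⟩ := exists_eq_projFrac (projCoeff i r ω)
  rw [hz, algebraMap_projFrac] at h3
  have hXp := SetLike.pow_mem_graded p (X_mem_grading i)
  have hc := SetLike.algebraMap_mem_graded (grading ℓ) (p.factorial : ℂ)⁻¹
  refine AddSubgroup.subset_closure ⟨_, _, _, _, r, SetLike.mul_mem_graded hc ha,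
    SetLike.mul_mem_graded hb hXp, mul_ne_zero hb0 (pow_ne_zero _ (MvPolynomial.X_ne_zero i)),
    ?_, ?_⟩
  · simp
  · congr 1
    have h4 := eq_div_of_mul_eq (pow_ne_zero p hX) ((mul_comm _ _).trans h3.symm)
    rw [h4, map_mul, map_mul, map_pow, ← IsScalarTower.algebraMap_apply, map_inv₀, map_natCast,
      div_div, mul_div_assoc]

variable (p : ℕ)

theorem localizedModule_lift_mk_one {R M N : Type*} [CommRing R] [AddCommGroup M] [AddCommGroup N]
    [Module R M] [Module R N] (S : Submonoid R) (g : M →ₗ[R] N)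
    (h : ∀ s : S, IsUnit (algebraMap R (Module.End R N) s)) (m : M) :
    LocalizedModule.lift S g h (LocalizedModule.mk m 1) = g m :=
  LinearMap.congr_fun (LocalizedModule.lift_comp S g h) m

theorem Arrangement.smul_fractionForm_mk (x : ProjectiveSpectrum (grading ℓ)) (m : 𝒜.logForms₀ p)
    (s : x.asHomogeneousIdeal.toIdeal.primeCompl) :
    (s : CoordRing ℓ) • 𝒜.fractionForm p x (LocalizedModule.mk m s) = m := by
  rw [← map_smul, LocalizedModule.smul'_mk]
  have h := LocalizedModule.mk_cancel s m
  refine (congrArg _ h).trans ?_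
  rw [Arrangement.fractionForm, localizedModule_lift_mk_one]
  rfl

theorem Arrangement.fractionForm_mk (x : ProjectiveSpectrum (grading ℓ)) (m : 𝒜.logForms₀ p)
    (s : x.asHomogeneousIdeal.toIdeal.primeCompl) :
    𝒜.fractionForm p x (LocalizedModule.mk m s) =
      (algebraMap _ (RatFun ℓ) (s : CoordRing ℓ))⁻¹ • (m : RatForms ℓ) := by
  rw [← 𝒜.smul_fractionForm_mk p x m s, ← algebraMap_smul_forms (s : CoordRing ℓ), smul_smul,
    inv_mul_cancel₀ (algebraMap_ne_zero (ne_zero_of_notMem x s.2)), one_smul]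

/-- `Ω^p_0(𝒜)` lies in a vector space over `ℂ(V)`, so localization loses nothing. -/
theorem Arrangement.fractionForm_injective (x : ProjectiveSpectrum (grading ℓ)) :
    Function.Injective (𝒜.fractionForm p x) := by
  refine (injective_iff_map_eq_zero _).2 fun z hz => ?_
  induction z using LocalizedModule.induction_on with
  | h m s =>
    have h := 𝒜.smul_fractionForm_mk p x m s
    rw [hz, smul_zero] at h
    rw [show m = 0 from Subtype.ext h.symm, LocalizedModule.zero_mk]

theorem Arrangement.fractionForm_smul (x : ProjectiveSpectrum (grading ℓ)) (r : LocalRingAt x)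
    (z : (𝒜.tildeSections p).N x) : 𝒜.fractionForm p x (r • z) =
      algebraMap _ (RatFun ℓ) (algebraMap _ (ProjRatFun ℓ) r) • 𝒜.fractionForm p x z := by
  obtain ⟨⟨e, a, b, hb⟩, rfl⟩ := HomogeneousLocalization.mk_surjective r
  have h (z : (𝒜.tildeSections p).N x) (m : 𝒜.logForms₀ p)
      (s : x.asHomogeneousIdeal.toIdeal.primeCompl) (hz : z = LocalizedModule.mk m s) :
      (HomogeneousLocalization.mk ⟨e, a, b, hb⟩ : LocalRingAt x) • z =
        LocalizedModule.mk ((a : CoordRing ℓ) • m) (⟨b, hb⟩ * s) := by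
    subst hz
    change HomogeneousLocalization.val (x := x.asHomogeneousIdeal.toIdeal.primeCompl)
      (.mk ⟨e, a, b, hb⟩) • LocalizedModule.mk m s = _
    rw [HomogeneousLocalization.val_mk, LocalizedModule.mk_smul_mk]
  induction z using LocalizedModule.induction_on with
  | h m s =>
    rw [algebraMap_mk]
    refine (congrArg (𝒜.fractionForm p x) (h _ m s rfl)).trans ?_
    rw [𝒜.fractionForm_mk, 𝒜.fractionForm_mk, Submodule.coe_smul,
      ← algebraMap_smul_forms (a : CoordRing ℓ), smul_smul, smul_smul, Submonoid.coe_mul, map_mul,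
      mul_inv_rev, div_eq_mul_inv]
    congr 1
    ring

/-- The relation between the values of sections of the two sheaves. -/
def Arrangement.SameForm (x : ProjectiveSpectrum (grading ℓ)) (z : (𝒜.tildeSections p).N x)
    (ω : ProjRatForms ℓ) : Prop :=
  ω ∈ pForms ℂ (ProjRatFun ℓ) p ∧ projPullback ℓ ω = 𝒜.fractionForm p x z

theorem Arrangement.SameForm.add {𝒜 : Arrangement ℓ} {p : ℕ} {x : ProjectiveSpectrum (grading ℓ)}
    {z z' : (𝒜.tildeSections p).N x} {ω ω' : ProjRatForms ℓ} (h : 𝒜.SameForm p x z ω)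
    (h' : 𝒜.SameForm p x z' ω') : 𝒜.SameForm p x (z + z') (ω + ω') :=
  ⟨add_mem h.1 h'.1, by rw [map_add, h.2, h'.2]; exact (map_add (𝒜.fractionForm p x) z z').symm⟩

theorem Arrangement.SameForm.smul {𝒜 : Arrangement ℓ} {p : ℕ}
    {x : ProjectiveSpectrum (grading ℓ)} {z : (𝒜.tildeSections p).N x} {ω : ProjRatForms ℓ}
    (r : LocalRingAt x) (h : 𝒜.SameForm p x z ω) : 𝒜.SameForm p x (r • z) (r • ω) := by
  rw [← algebraMap_smul_forms r]
  exact ⟨Submodule.smul_mem _ _ h.1, by rw [projPullback_smul, h.2, 𝒜.fractionForm_smul]⟩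

theorem Arrangement.SameForm.unique {𝒜 : Arrangement ℓ} {p : ℕ}
    {x : ProjectiveSpectrum (grading ℓ)} {z : (𝒜.tildeSections p).N x} {ω ω' : ProjRatForms ℓ}
    (h : 𝒜.SameForm p x z ω) (h' : 𝒜.SameForm p x z ω') : ω = ω' := by
  obtain ⟨i, -⟩ := exists_X_notMem x
  refine sub_eq_zero.1 (projPullback_eq_zero i (sub_mem h.1 h'.1) ?_)
  rw [map_sub, h.2, h'.2, sub_self]

/-- The descended form depends on `m / t` alone, so one `ω` serves all `y` with `t ∉ y`; the point
`x` ensures only that `t ≠ 0` and that a chart exists. -/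
theorem Arrangement.exists_projLogForms (d : ℕ) (m : 𝒜.logForms₀ p)
    (hm : m ∈ 𝒜.logForms₀Degree p d) (t : CoordRing ℓ) (ht : t ∈ grading ℓ d)
    (x : ProjectiveSpectrum (grading ℓ)) (htx : t ∉ x.asHomogeneousIdeal) :
    ∃ ω : ProjRatForms ℓ, ∀ y : ProjectiveSpectrum (grading ℓ),
      ∀ hty : t ∉ y.asHomogeneousIdeal, ω ∈ 𝒜.projLogForms y p ∧
        𝒜.SameForm p y (LocalizedModule.mk m ⟨t, hty⟩) ω := by
  obtain ⟨i, -⟩ := exists_X_notMem x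
  obtain ⟨ω, hω, h⟩ := exists_projPullback_eq i hm m.2.2 ht (ne_zero_of_notMem x htx)
  refine ⟨ω, fun y hty => ⟨𝒜.mem_projLogForms_of_smul_mem hω ht hty ?_, hω,
    h.trans (𝒜.fractionForm_mk p y m ⟨t, hty⟩).symm⟩⟩
  have h3 : t • projPullback ℓ ω = m := by
    rw [h, ← algebraMap_smul_forms t, smul_smul,
      mul_inv_cancel₀ (algebraMap_ne_zero (ne_zero_of_notMem x htx)), one_smul]
    rfl
  rw [h3]
  exact m.2.1

/-- A common denominator `t` makes `m = t π^* ω` logarithmic; it is homogeneous of degree `deg t`,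
and `ι_χ` annihilates it as it does every pullback. -/
theorem Arrangement.exists_fraction {x : ProjectiveSpectrum (grading ℓ)} {ω : ProjRatForms ℓ}
    (hω : ω ∈ 𝒜.projLogForms x p) : ∃ (d : ℕ) (m : 𝒜.logForms₀ p) (t : CoordRing ℓ),
      m ∈ 𝒜.logForms₀Degree p d ∧ t ∈ grading ℓ d ∧ t ∉ x.asHomogeneousIdeal ∧
        ∀ (y : ProjectiveSpectrum (grading ℓ)) (hty : t ∉ y.asHomogeneousIdeal),
          𝒜.SameForm p y (LocalizedModule.mk m ⟨t, hty⟩) ω := by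
  obtain ⟨i, -⟩ := exists_X_notMem x
  obtain ⟨hp, d, t, ht, htx, h⟩ := 𝒜.exists_smul_mem_logForms hω
  have hχ : eulerContract ℓ (t • projPullback ℓ ω) = 0 := by
    rw [← algebraMap_smul_forms t, map_smul, eulerContract_projPullback, smul_zero]
  refine ⟨d, ⟨t • projPullback ℓ ω, h, hχ⟩, t, ?_, ht, htx, fun y hty => ⟨hp, ?_⟩⟩
  · have := smul_mem_homogeneousForms ht (projPullback_mem_homogeneousForms i hp)
    rwa [add_zero] at this
  · rw [𝒜.fractionForm_mk]
    change _ = (algebraMap _ (RatFun ℓ) t)⁻¹ • t • projPullback ℓ ω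
    rw [← algebraMap_smul_forms t (projPullback ℓ ω), smul_smul,
      inv_mul_cancel₀ (algebraMap_ne_zero (ne_zero_of_notMem x htx)), one_smul]

/-- The transfer from `Ω^p_0(𝒜)^~` to `Ω^p(ℙ𝒜)`. -/
def Arrangement.toProjLog : (𝒜.tildeSections p).Transfer (𝒜.projLogSections p) where
  rel x z w := 𝒜.SameForm p x z w
  add := Arrangement.SameForm.add
  smul := Arrangement.SameForm.smul
  unique := Arrangement.SameForm.unique
  forth := by
    rintro ⟨d, ⟨m, hm⟩, ⟨t, ht⟩⟩ x - ⟨htx, -⟩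
    obtain ⟨ω, h⟩ := 𝒜.exists_projLogForms p d m hm t ht x htx
    -- No shrinking is needed: that the fraction gives a value at `y` already includes `t ∉ y`.
    refine ⟨ω, ⊤, trivial, ?_⟩
    rintro y - _ ⟨hty, rfl⟩
    exact ⟨ω, ⟨(h y hty).1, rfl⟩, (h y hty).2⟩

/-- The transfer from `Ω^p(ℙ𝒜)` to `Ω^p_0(𝒜)^~`. -/
def Arrangement.ofProjLog : (𝒜.projLogSections p).Transfer (𝒜.tildeSections p) where
  rel x w z := 𝒜.SameForm p x z w
  add := Arrangement.SameForm.add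
  smul := Arrangement.SameForm.smul
  unique h h' := 𝒜.fractionForm_injective p _ (h.2.symm.trans h'.2)
  forth := by
    rintro ω x _ ⟨hω, rfl⟩
    obtain ⟨d, m, t, hm, ht, htx, h⟩ := 𝒜.exists_fraction p hω
    -- Here the neighbourhood must shrink to where the denominator is invertible.
    refine ⟨⟨d, ⟨m, hm⟩, ⟨t, ht⟩⟩, ProjectiveSpectrum.basicOpen _ t, htx, ?_⟩
    rintro y hty _ ⟨-, rfl⟩
    exact ⟨LocalizedModule.mk m ⟨t, hty⟩, ⟨hty, rfl⟩, h y hty⟩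

end Comparison

end LogForms

end

theorem mainTheorem4 (ℓ : ℕ) (𝒜 : LogForms.Arrangement ℓ) (p : ℕ) :
    ∃ e : 𝒜.tilde p ≅ 𝒜.projLogSheaf p,
      ∀ (U : (AlgebraicGeometry.Proj (LogForms.grading ℓ)).Opens) (s : Γ(𝒜.tilde p, U))
        (x : ProjectiveSpectrum (LogForms.grading ℓ)) (hx : x ∈ U),
        LogForms.projPullback ℓ ((𝒜.projLogSections p).value (e.hom.app U s) x hx) =
          𝒜.fractionForm p x ((𝒜.tildeSections p).value s x hx) :=
  ⟨(𝒜.toProjLog p).iso (𝒜.ofProjLog p) fun _ _ _ => Iff.rfl, fun _ s x hx =>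
    ((𝒜.toProjLog p).rel_value_hom s x hx).2⟩
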